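/- **Proposition.** Let $K$ be a field and $0\neq q\in K$. Let $V(z)$ be the evaluation module of $U_q(\widehat{\mathfrak{sl}}_2)$, with basis $\{z^jv_m : j\in\mathbb Z,\ m=1,2\}$, and consider formal (possibly infinite) linear combinations of pure tensors $z_1^{d_1}v_{m_1}\otimes z_2^{d_2}v_{m_2}\otimes\cdots$ in $V(z_1)\otimes V(z_2)\otimes\cdots$. Let the Hecke generators $T_i$ ($i\ge 1$), which satisfy $T_i^2=(q^2-1)T_i+q^2$, act on the right in the factors $i,i+1$ as follows: writing a tensor as $(v_{m_1}\otimes v_{m_2}\otimes\cdots)\cdot\mathbf z$ with a Laurent monomial $\mathbf z$, and writing $\sigma_i$ for the exchange of the $i$-th and $(i+1)$-st vectors, respectively exponents, $$((v_{m_1}\otimes v_{m_2}\otimes\cdots)\,\mathbf z)\cdot T_i=\begin{cases}-q\,(v_{m_1}\otimes\cdots)^{\sigma_i}\,\mathbf z^{\sigma_i}-(q^2-1)(v_{m_1}\otimes\cdots)\frac{z_{i+1}\mathbf z^{\sigma_i}-z_i\mathbf z}{z_i-z_{i+1}}& m_i<m_{i+1},\\[2pt]-(v_{m_1}\otimes\cdots)\,\mathbf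 z^{\sigma_i}-(q^2-1)(v_{m_1}\otimes\cdots)\frac{z_i(\mathbf z^{\sigma_i}-\mathbf z)}{z_i-z_{i+1}}& m_i=m_{i+1},\\[2pt]-q\,(v_{m_1}\otimes\cdots)^{\sigma_i}\,\mathbf z^{\sigma_i}-(q^2-1)(v_{m_1}\otimes\cdots)\frac{z_i(\mathbf z^{\sigma_i}-\mathbf z)}{z_i-z_{i+1}}& m_i>m_{i+1}.\end{cases}$$ Let $S_\infty$ be the group of finitely supported permutations of $\{1,2,\dots\}$; for a minimal length expansion $\sigma=\sigma_{i_1}\cdots\sigma_{i_l}$ into adjacent transpositions put $T_\sigma=T_{i_1}\cdots T_{i_l}$, and define the $q$-wedge $$z^{d_1}v_{m_1}\wedge_q z^{d_2}v_{m_2}\wedge_q\cdots=\sum_{\sigma\in S_\infty}(z_1^{d_1}v_{m_1}\otimes z_2^{d_2}v_{m_2}\otimes\cdots)\cdot T_\sigma ,$$ the sum being taken coefficientwise. Put $v_{\Lambda_0}=zv_2\wedge_q zv_1\wedge_q z^2v_2\wedge_q z^2v_1\wedge_q\cdots$ and $v_{\Lambda_1}=zv_1\wedge_q z^2v_2\wedge_q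 z^2v_1\wedge_q\cdots$, let $F_{(i)}$ be the span of the $q$-wedges that agree with $v_{\Lambda_i}$ after finitely many factors, and let $V(z)\,\widehat\otimes\,F_{(1)}$ be the space of possibly infinite sums $\sum_{j,m}z^jv_m\otimes y_{j,m}$ with $y_{j,m}\in F_{(1)}$. Let $\widetilde\Phi_{(0)}$ be the map on $F_{(0)}$ that splits off the first component of every pure tensor. Then in $v_{\Lambda_0}$, and in each wedge obtained from $v_{\Lambda_0}$ by leaving out one factor, every pure tensor receives nonzero contributions from only finitely many $\sigma\in S_\infty$, so that these $q$-wedges are well defined; the vector $\widetilde\Phi_{(0)}(v_{\Lambda_0})$ lies in $V(z)\,\widehat\otimes\,F_{(1)}$; and $$\begin{aligned}\widetilde\Phi_{(0)}(v_{\Lambda_0})={}&\sum_{j=1}^{\infty}q^{3(j-1)}\,z^jv_2\otimes(zv_2\wedge_q zv_1\wedge_q\cdots\wedge_q z^{j-1}v_1\wedge_q z^jv_1\wedge_q z^{j+1}v_2\wedge_q\cdots)\\&-\sum_{j=1}^{\infty}q^{3(j-1)+1}\,z^jv_1\otimes(zv_2\wedge_q zv_1\wedge_q\cdots\wedge_q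 z^jv_2\wedge_q z^{j+1}v_2\wedge_q z^{j+1}v_1\wedge_q\cdots),\end{aligned}$$ where the wedge in the $j$-th term of the first (second) sum is $v_{\Lambda_0}$ with the factor $z^jv_2$ (respectively $z^jv_1$) left out, and each coefficient of the two infinite sums receives only finitely many nonzero contributions. -/

import Mathlib

noncomputable section

namespace QWedge

/-! ### The infinite symmetric group

Positions of tensor factors are numbered `0, 1, 2, …`. -/

/-- `S_∞`: the permutations of the positions that fix all but finitely many of them. -/
def SInf : Subgroup (Equiv.Perm ℕ) where
  carrier := {σ | {k | σ k ≠ k}.Finite}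
  one_mem' := by simp
  mul_mem' := by
    intro a b ha hb
    refine (ha.union hb).subset fun k hk => ?_
    by_contra h
    simp only [Set.mem_union, Set.mem_ofPred_eq, not_or, not_not] at h
    exact hk (by rw [Equiv.Perm.mul_apply, h.2, h.1])
  inv_mem' := by
    intro a ha
    refine Set.Finite.subset ha fun k hk h => hk ?_
    rw [Equiv.Perm.inv_eq_iff_eq]
    exact h.symm

/-- The adjacent transposition exchanging the positions `i` and `i + 1`. -/
def adj (i : ℕ) : Equiv.Perm ℕ := Equiv.swap i (i + 1)

/-- `l = [i₁, …, i_l]` is a minimal length expansion `σ = σ_{i₁} ⋯ σ_{i_l}`. -/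
def IsReducedWord (l : List ℕ) (σ : Equiv.Perm ℕ) : Prop :=
  (l.map adj).prod = σ ∧ ∀ l' : List ℕ, (l'.map adj).prod = σ → l.length ≤ l'.length

theorem swap_mem_closure_adj (a b : ℕ) :
    Equiv.swap a b ∈ Submonoid.closure (Set.range adj) := by
  have key : ∀ a d : ℕ, Equiv.swap a (a + d) ∈ Submonoid.closure (Set.range adj) := by
    intro a d
    induction d with
    | zero => rw [add_zero, Equiv.swap_self]; exact Submonoid.one_mem _
    | succ d ih =>
      exact SubmonoidClass.swap_mem_trans _ ih (Submonoid.subset_closure ⟨a + d, rfl⟩)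
  rcases le_total a b with h | h
  · obtain ⟨d, rfl⟩ := Nat.exists_eq_add_of_le h
    exact key a d
  · obtain ⟨d, rfl⟩ := Nat.exists_eq_add_of_le h
    rw [Equiv.swap_comm]
    exact key b d

theorem exists_word (σ : SInf) : ∃ l : List ℕ, (l.map adj).prod = (σ : Equiv.Perm ℕ) := by
  have h1 : (σ : Equiv.Perm ℕ) ∈
      Subgroup.closure {τ : Equiv.Perm ℕ | τ.IsSwap} := by
    rw [mem_closure_isSwap']
    refine σ.2.subset fun k hk => ?_
    simpa [MulAction.mem_fixedBy] using hk
  have h2 : (σ : Equiv.Perm ℕ) ∈ Submonoid.closure (Set.range adj) := by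
    generalize (σ : Equiv.Perm ℕ) = τ at h1
    induction h1 using Subgroup.closure_induction'' with
    | mem x hx => obtain ⟨a, b, -, rfl⟩ := hx; exact swap_mem_closure_adj a b
    | inv_mem x hx =>
      obtain ⟨a, b, -, rfl⟩ := hx; rw [Equiv.swap_inv]; exact swap_mem_closure_adj a b
    | one => exact Submonoid.one_mem _
    | mul x y _ _ hx hy => exact Submonoid.mul_mem _ hx hy
  obtain ⟨l, hl, hp⟩ := Submonoid.exists_list_of_mem_closure h2
  choose! f hf using hl
  refine ⟨l.map f, ?_⟩
  rw [List.map_map, ← hp]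
  congr 1
  conv_rhs => rw [← List.map_id l]
  exact List.map_congr_left fun x hx => hf x hx

theorem exists_reducedWord (σ : SInf) : ∃ l : List ℕ, IsReducedWord l σ := by
  obtain ⟨l, hl, hmin⟩ := WellFounded.has_min
    (InvImage.wf (List.length (α := ℕ)) Nat.lt_wfRel.wf)
    {l : List ℕ | (l.map adj).prod = (σ : Equiv.Perm ℕ)} (exists_word σ)
  exact ⟨l, hl, fun l' hl' => not_lt.1 (hmin l' hl')⟩

/-- A reduced word of `σ`. -/
def reducedWord (σ : SInf) : List ℕ := (exists_reducedWord σ).choose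

theorem isReducedWord_reducedWord (σ : SInf) : IsReducedWord (reducedWord σ) σ :=
  (exists_reducedWord σ).choose_spec

/-! ### Evaluation modules and pure tensors -/

/-- Labels of the basis `z ^ j v_m` of the evaluation module `V(z)`: the vector `z ^ j v_m`,
`1 ≤ m ≤ n`, has the label `(j, m - 1)`. -/
abbrev Label (n : ℕ) : Type := ℤ × Fin n

/-- The evaluation module `V(z) = Kⁿ ⊗ K[z, z⁻¹]`. -/
abbrev Eval (K : Type*) [Field K] (n : ℕ) : Type _ := Label n →₀ K

/-- The infinite pure tensors `z₁ ^ d₁ v_{m₁} ⊗ z₂ ^ d₂ v_{m₂} ⊗ ⋯`. -/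
abbrev PureTensor (n : ℕ) : Type := ℕ → Label n

/-- Formal, possibly infinite, linear combinations of infinite pure tensors: the completion of
`V(z₁) ⊗ V(z₂) ⊗ ⋯`, an element being given by its coefficients. -/
abbrev FormalTensor (K : Type*) [Field K] (n : ℕ) : Type _ := PureTensor n → K

/-! ### The action of the Hecke algebra -/

section Hecke

variable {K : Type*} [Field K] {n : ℕ}

variable (K) in
/-- The Laurent monomial `z₁ ^ a z₂ ^ b`, in the ring of Laurent polynomials in `z₁, z₂`. -/
def mono (a b : ℤ) : AddMonoidAlgebra K (ℤ × ℤ) := AddMonoidAlgebra.single (a, b) 1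

variable (K) in
/-- The Laurent polynomial `(z₁ ^ a z₂ ^ b - z₁ ^ b z₂ ^ a) / (z₁ - z₂)`, see `divDiff_spec`. -/
def divDiff (a b : ℤ) : AddMonoidAlgebra K (ℤ × ℤ) :=
  if b ≤ a then ∑ s ∈ Finset.range (a - b).toNat, mono K (a - 1 - s) (b + s)
  else -∑ s ∈ Finset.range (b - a).toNat, mono K (b - 1 - s) (a + s)

theorem mono_mul (a b c d : ℤ) : mono K a b * mono K c d = mono K (a + c) (b + d) := by
  simp [mono, AddMonoidAlgebra.single_mul_single]

theorem sub_mul_sum_mono (a b : ℤ) (h : b ≤ a) :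
    (mono K 1 0 - mono K 0 1) *
      ∑ s ∈ Finset.range (a - b).toNat, mono K (a - 1 - s) (b + s) =
        mono K a b - mono K b a := by
  have hstep : ∀ s : ℕ, (mono K 1 0 - mono K 0 1) * mono K (a - 1 - s) (b + s) =
      mono K (a - (s : ℕ)) (b + (s : ℕ)) - mono K (a - ((s + 1 : ℕ) : ℤ)) (b + ((s + 1 : ℕ) : ℤ)) := by
    intro s
    rw [sub_mul, mono_mul, mono_mul]
    push_cast
    congr 2 <;> ring
  rw [Finset.mul_sum, Finset.sum_congr rfl fun s _ => hstep s,
    Finset.sum_range_sub' (fun s : ℕ => mono K (a - (s : ℤ)) (b + (s : ℤ)))]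
  have : (((a - b).toNat : ℕ) : ℤ) = a - b := Int.toNat_of_nonneg (by omega)
  rw [this]
  simp

/-- `divDiff K a b` is the quotient it is meant to be. -/
theorem divDiff_spec (a b : ℤ) :
    (mono K 1 0 - mono K 0 1) * divDiff K a b = mono K a b - mono K b a := by
  unfold divDiff
  split_ifs with h
  · exact sub_mul_sum_mono a b h
  · rw [mul_neg, sub_mul_sum_mono b a (by omega), neg_sub]

/-- `(v_m ⊗ v_l) · P` for a Laurent polynomial `P` in `z₁, z₂`, expanded in the basis of
`V(z₁) ⊗ V(z₂)`. -/
def attach (m l : Fin n) (P : AddMonoidAlgebra K (ℤ × ℤ)) : (Label n × Label n) →₀ K :=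
  P.coeff.mapDomain fun e => ((e.1, m), (e.2, l))

/-- The action of the generator `T` of `H₂(q²)` on the basis vector `(v_m ⊗ v_l) · 𝐳`,
`𝐳 = z₁ ^ j z₂ ^ k`, of `V(z₁) ⊗ V(z₂)`, with `𝐳^σ = z₁ ^ k z₂ ^ j`:
* `- q (v_l ⊗ v_m) 𝐳^σ - (q² - 1) (v_m ⊗ v_l) (z₂ 𝐳^σ - z₁ 𝐳) / (z₁ - z₂)` if `m < l`;
* `- (v_m ⊗ v_l) 𝐳^σ - (q² - 1) (v_m ⊗ v_l) z₁ (𝐳^σ - 𝐳) / (z₁ - z₂)` if `m = l`;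
* `- q (v_l ⊗ v_m) 𝐳^σ - (q² - 1) (v_m ⊗ v_l) z₁ (𝐳^σ - 𝐳) / (z₁ - z₂)` if `m > l`.
The quotients are identified in `quot_lt` and `quot_ge`. -/
def localT (q : K) : Label n → Label n → (Label n × Label n) →₀ K
  | (j, m), (k, l) =>
    if m < l then
      -(q • attach l m (mono K k j)) - (q ^ 2 - 1) • attach m l (divDiff K k (j + 1))
    else if m = l then
      -attach m l (mono K k j) - (q ^ 2 - 1) • attach m l (mono K 1 0 * divDiff K k j)
    else
      -(q • attach l m (mono K k j)) - (q ^ 2 - 1) • attach m l (mono K 1 0 * divDiff K k j)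

/-- `divDiff K k (j + 1) = (z₂ 𝐳^σ - z₁ 𝐳) / (z₁ - z₂)` for `𝐳 = z₁ ^ j z₂ ^ k`. -/
theorem quot_lt (j k : ℤ) :
    (mono K 1 0 - mono K 0 1) * divDiff K k (j + 1) =
      mono K 0 1 * mono K k j - mono K 1 0 * mono K j k := by
  rw [divDiff_spec, mono_mul, mono_mul]
  simp [add_comm]

/-- `z₁ * divDiff K k j = z₁ (𝐳^σ - 𝐳) / (z₁ - z₂)` for `𝐳 = z₁ ^ j z₂ ^ k`. -/
theorem quot_ge (j k : ℤ) :
    (mono K 1 0 - mono K 0 1) * (mono K 1 0 * divDiff K k j) =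
      mono K 1 0 * (mono K k j - mono K j k) := by
  rw [mul_left_comm, divDiff_spec]

/-- The right action of the Hecke generator `T` in the tensor factors at the positions `i` and
`i + 1` on finite linear combinations of pure tensors. -/
def heckeT (q : K) (i : ℕ) : (PureTensor n →₀ K) →ₗ[K] (PureTensor n →₀ K) :=
  Finsupp.linearCombination K fun t : PureTensor n =>
    (localT q (t i) (t (i + 1))).mapDomain fun p =>
      Function.update (Function.update t i p.1) (i + 1) p.2

/-- The right action `x · T_{i₁} T_{i₂} ⋯ T_{i_l}`. -/
def heckeWord (q : K) (l : List ℕ) (x : PureTensor n →₀ K) : PureTensor n →₀ K :=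
  l.foldl (fun y i => heckeT q i y) x

/-- The right action of `T_σ = T_{i₁} ⋯ T_{i_l}`, for a minimal length expansion
`σ = σ_{i₁} ⋯ σ_{i_l}`. -/
def actT (q : K) (σ : SInf) (x : PureTensor n →₀ K) : PureTensor n →₀ K :=
  heckeWord q (reducedWord σ) x

end Hecke

/-! ### Formal sums and `q`-wedges -/

section Wedge

variable {K : Type*} [Field K] {n : ℕ}

/-- A family of formal linear combinations is summable if every coefficient receives only
finitely many nonzero contributions. -/
def FormalSummable {ι X : Type*} (f : ι → X → K) : Prop :=
  ∀ x, {i | f i x ≠ 0}.Finite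

/-- The coefficientwise sum of a family of formal linear combinations. -/
def formalSum {ι X : Type*} (f : ι → X → K) : X → K := fun x => ∑ᶠ i, f i x

/-- The terms of the `q`-antisymmetrization of the pure tensor `t`, indexed by `S_∞`. -/
def wedgeTerm (q : K) (t : PureTensor n) (σ : SInf) : FormalTensor K n :=
  fun w => actT q σ (Finsupp.single t 1) w

/-- The `q`-wedge `z ^ d₁ v_{m₁} ∧_q z ^ d₂ v_{m₂} ∧_q ⋯ = ∑_{σ ∈ S_∞} t · T_σ`, where
`t = z₁ ^ d₁ v_{m₁} ⊗ z₂ ^ d₂ v_{m₂} ⊗ ⋯`. -/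
def wedge (q : K) (t : PureTensor n) : FormalTensor K n := formalSum (wedgeTerm q t)

/-- The simple tensor `x ⊗ y` of `x ∈ V(z)` and a formal tensor `y`, as an element of the
completed tensor product: a function of a basis label of `V(z)` and a pure tensor. -/
def tmul (x : Eval K n) (y : FormalTensor K n) : Label n × PureTensor n → K :=
  fun p => x p.1 * y p.2

/-- The completed tensor product `V(z) ⊗̂ F` for a space `F` of formal tensors: the sums
`∑_b b ⊗ y_b` over the basis vectors `b` of `V(z)`, possibly infinite, with all `y_b ∈ F`. -/
def completedTensor (F : Submodule K (FormalTensor K n)) :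
    Submodule K (Label n × PureTensor n → K) where
  carrier := {y | ∀ b, (fun w => y (b, w)) ∈ F}
  zero_mem' := fun _ => F.zero_mem
  add_mem' := fun hx hy b => F.add_mem (hx b) (hy b)
  smul_mem' := fun c _ hx b => F.smul_mem c (hx b)

/-- The pure tensor `b ⊗ t`. -/
def consTensor (b : Label n) (t : PureTensor n) : PureTensor n
  | 0 => b
  | k + 1 => t k

/-- The pure tensor `t` with its factor at position `r` left out. -/
def omitFactor (r : ℕ) (t : PureTensor n) : PureTensor n :=
  fun k => if k < r then t k else t (k + 1)

/-- Splitting off the first component of every pure tensor. -/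
def splitFirst : FormalTensor K n →ₗ[K] (Label n × PureTensor n → K) where
  toFun f := fun p => f (consTensor p.1 p.2)
  map_add' _ _ := rfl
  map_smul' _ _ := rfl

end Wedge

/-! ### The case `n = 2` -/

section SlTwo

/-- The label of `z ^ j v₁`. -/
def zv₁ (j : ℤ) : Label 2 := (j, 0)

/-- The label of `z ^ j v₂`. -/
def zv₂ (j : ℤ) : Label 2 := (j, 1)

/-- The pure tensor `z v₂ ⊗ z v₁ ⊗ z² v₂ ⊗ z² v₁ ⊗ ⋯`. -/
def vacuum₀ : PureTensor 2 :=
  fun k => if Even k then zv₂ ((k / 2 : ℕ) + 1) else zv₁ ((k / 2 : ℕ) + 1)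

/-- The pure tensors whose antisymmetrizations are the highest weight vectors `v_{Λ₀}` and
`v_{Λ₁}`: `z v₂ ⊗ z v₁ ⊗ z² v₂ ⊗ ⋯` for `i = 0` and `z v₁ ⊗ z² v₂ ⊗ z² v₁ ⊗ ⋯` for `i = 1`. -/
def vacuum (i : Fin 2) : PureTensor 2 := fun k => vacuum₀ (k + i)

theorem vacuum_zero_even (j : ℕ) : vacuum 0 (2 * j) = zv₂ (j + 1) := by
  simp [vacuum, vacuum₀]

theorem vacuum_zero_odd (j : ℕ) : vacuum 0 (2 * j + 1) = zv₁ (j + 1) := by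
  have h : (2 * j + 1) / 2 = j := by omega
  simp [vacuum, vacuum₀, h]

variable {K : Type*} [Field K]

/-- `F_(i)`: the span of the `q`-wedges that agree with `v_{Λ_i}` after finitely many factors. -/
def Fock (q : K) (i : Fin 2) : Submodule K (FormalTensor K 2) :=
  Submodule.span K
    {x | ∃ t : PureTensor 2, (∃ N, ∀ k ≥ N, t k = vacuum i k) ∧ x = wedge q t}

/-- The highest weight vector `v_{Λ_i} ∈ F_(i)`. -/
def highestWeight (q : K) (i : Fin 2) : Fock q i :=
  ⟨wedge q (vacuum i), Submodule.subset_span ⟨vacuum i, ⟨0, fun _ _ => rfl⟩, rfl⟩⟩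

/-- The operator `Φ̃_(i)` on `F_(i)`, which splits off the first component of every tensor. -/
def PhiTilde (q : K) (i : Fin 2) : Fock q i →ₗ[K] (Label 2 × PureTensor 2 → K) :=
  splitFirst ∘ₗ (Fock q i).subtype

/-- `z ^ j v₂ ⊗ (z v₂ ∧_q z v₁ ∧_q ⋯ ∧_q z ^ (j-1) v₁ ∧_q z ^ j v₁ ∧_q z ^ (j+1) v₂ ∧_q ⋯)`: the
second factor is the wedge obtained from `v_{Λ₀}` by leaving out `z ^ j v₂`.
Here `j = s + 1`, `s = 0, 1, 2, …`. -/
def termTwo (q : K) (s : ℕ) : Label 2 × PureTensor 2 → K :=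
  tmul (Finsupp.single (zv₂ (s + 1)) 1) (wedge q (omitFactor (2 * s) (vacuum 0)))

/-- `z ^ j v₁ ⊗ (z v₂ ∧_q z v₁ ∧_q ⋯ ∧_q z ^ j v₂ ∧_q z ^ (j+1) v₂ ∧_q z ^ (j+1) v₁ ∧_q ⋯)`: the
second factor is the wedge obtained from `v_{Λ₀}` by leaving out `z ^ j v₁`.
Here `j = s + 1`, `s = 0, 1, 2, …`. -/
def termOne (q : K) (s : ℕ) : Label 2 × PureTensor 2 → K :=
  tmul (Finsupp.single (zv₁ (s + 1)) 1) (wedge q (omitFactor (2 * s + 1) (vacuum 0)))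

end SlTwo

end QWedge

end

open QWedge

/-!
The first factor of the tensors in `v_{Λ₀}` is found by splitting the antisymmetrizer along the
cosets of the stabilizer of the first position.

Let `u_0 = z v₂`, `u_1 = z v₁`, `u_2 = z² v₂`, … be the factors of `v_{Λ₀}`, in the order measured by
`height`. If `a` comes before `b`, then `(a ⊗ b) · T` is `-q ^ 2 (b ⊗ a)` or `-q (b ⊗ a)`, according
to whether `a` and `b` have the same label `m` or not, plus tensors whose factors lie strictly between
`a` and `b` (`localT_of_lt`). Hence, if the factor of `t` at position `M` is the largest up to there,
every `σ ∈ S_{M+1}` that moves `M` removes it from this position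
(`actT_mem_of_notMem_permsBelow`). So the coefficient of a fixed tensor in a wedge only involves a
finite symmetric group `S_M`, and the wedge is given by `∑_{σ ∈ S_M} T_σ` (`wedge_apply`).

The elements `T_σ` are independent of the reduced words, by Matsumoto's theorem
(`prod_map_eq_of_reduced`) and the braid relations (`heckeT_braid`). The latter are checked in the
field of fractions of the Laurent polynomials, into which the action is embedded by `realize` and
where it is given by Demazure–Lusztig operators. Consequently
* `∑_{σ ∈ S_M} T_σ` is divisible by `1 + T_i` on the left (`IsHecke.exists_symmetrizer_eq`), which
  makes the wedge vanish on tensors with two equal neighbours;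
* `∑_{σ ∈ S_{M+1}} T_σ = (∑_{r ≤ M} T_{r-1} ⋯ T_1 T_0) ∑_τ T_τ`, where `τ` permutes the positions
  `1, …, M` (`IsHecke.symmetrizer_succ`).

Applying `T_{r-1} ⋯ T_0` to the vacuum moves `u_r` to the front. The leading term is `u_r` followed by
the vacuum without `u_r`, and the product of the scalars `-q ^ 2` and `-q` of the exchanges is
`q ^ (3 s)` for `r = 2 s` and `-q ^ (3 s + 1)` for `r = 2 s + 1`. All other terms contain
`u_l ⊗ u_{i+1} ⊗ u_{i+2} ⊗ ⋯ ⊗ u_l` behind the first factor (`dragOp_vacInsert`), and on such tensors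
the wedge vanishes by induction on the length of this pattern (`symmOp_single_eq_zero`).
-/

namespace QWedge

/-! ### Inversions and reduced words -/

/-- The inversions of a permutation of the positions. -/
def inversions (σ : Equiv.Perm ℕ) : Set (ℕ × ℕ) := {p | p.1 < p.2 ∧ σ p.2 < σ p.1}

/-- The number of inversions, which is the Coxeter length (see `isReducedWord_iff`). It is only
meaningful on `S_∞`, where the set of inversions is finite. -/
noncomputable def invCount (σ : Equiv.Perm ℕ) : ℕ := (inversions σ).ncard

/-- The permutations that fix every position from `M` on, a copy of the symmetric group `S_M`. -/
def permsBelow (M : ℕ) : Subgroup (Equiv.Perm ℕ) where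
  carrier := {σ | ∀ k ≥ M, σ k = k}
  one_mem' := by simp
  mul_mem' := by
    intro a b ha hb k hk
    rw [Equiv.Perm.mul_apply, hb k hk, ha k hk]
  inv_mem' := by
    intro a ha k hk
    rw [Equiv.Perm.inv_eq_iff_eq, ha k hk]

theorem permsBelow_le_SInf (M : ℕ) : permsBelow M ≤ SInf := by
  intro σ hσ
  refine (Set.finite_lt_nat M).subset fun k hk => ?_
  by_contra h
  exact hk (hσ k (not_lt.1 h))

theorem permsBelow_mono {M N : ℕ} (h : M ≤ N) : permsBelow M ≤ permsBelow N :=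
  fun _ hσ k hk => hσ k (h.trans hk)

theorem exists_mem_permsBelow {σ : Equiv.Perm ℕ} (hσ : σ ∈ SInf) : ∃ M, σ ∈ permsBelow M := by
  obtain ⟨b, hb⟩ := Set.Finite.bddAbove (show {k | σ k ≠ k}.Finite from hσ)
  refine ⟨b + 1, fun k hk => ?_⟩
  by_contra h
  have := hb h
  omega

theorem lt_of_mem_permsBelow {M : ℕ} {σ : Equiv.Perm ℕ} (hσ : σ ∈ permsBelow M) {k : ℕ}
    (hk : k < M) : σ k < M := by
  by_contra h
  have h1 := hσ (σ k) (not_lt.1 h)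
  have h2 := σ.injective h1
  omega

theorem adj_mem_permsBelow {i M : ℕ} (h : i + 1 < M) : adj i ∈ permsBelow M := by
  intro k hk
  exact Equiv.swap_apply_of_ne_of_ne (by omega) (by omega)

theorem adj_mem_SInf (i : ℕ) : adj i ∈ SInf :=
  permsBelow_le_SInf (i + 2) (adj_mem_permsBelow (by omega))

@[simp] theorem adj_apply_left (i : ℕ) : adj i i = i + 1 := Equiv.swap_apply_left _ _

@[simp] theorem adj_apply_right (i : ℕ) : adj i (i + 1) = i := Equiv.swap_apply_right _ _

theorem adj_apply_of_ne {i k : ℕ} (h : k ≠ i) (h' : k ≠ i + 1) : adj i k = k :=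
  Equiv.swap_apply_of_ne_of_ne h h'

@[simp] theorem adj_mul_self (i : ℕ) : adj i * adj i = 1 := Equiv.swap_mul_self _ _

@[simp] theorem adj_inv (i : ℕ) : (adj i)⁻¹ = adj i := Equiv.swap_inv _ _

theorem mul_adj_mul_adj (σ : Equiv.Perm ℕ) (i : ℕ) : σ * adj i * adj i = σ := by
  rw [mul_assoc, adj_mul_self, mul_one]

@[simp] theorem adj_adj (i k : ℕ) : adj i (adj i k) = k := Equiv.swap_apply_self _ _ _

theorem adj_lt_adj {i a b : ℕ} (h : a < b) (hne : ¬(a = i ∧ b = i + 1)) : adj i a < adj i b := by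
  unfold adj
  rw [Equiv.swap_apply_def, Equiv.swap_apply_def]
  split_ifs <;> omega

theorem adj_comm {i j : ℕ} (h : i + 2 ≤ j) : adj i * adj j = adj j * adj i := by
  ext k
  simp only [Equiv.Perm.mul_apply, adj, Equiv.swap_apply_def]
  split_ifs <;> omega

theorem adj_braid (i : ℕ) :
    adj i * adj (i + 1) * adj i = adj (i + 1) * adj i * adj (i + 1) := by
  ext k
  simp only [Equiv.Perm.mul_apply, adj, Equiv.swap_apply_def]
  split_ifs <;> omega

theorem finite_inversions {σ : Equiv.Perm ℕ} (hσ : σ ∈ SInf) : (inversions σ).Finite := by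
  obtain ⟨M, hM⟩ := exists_mem_permsBelow hσ
  refine ((Set.finite_lt_nat M).prod (Set.finite_lt_nat M)).subset ?_
  rintro ⟨a, b⟩ ⟨h1, h2⟩
  simp only at h1 h2
  have hb : b < M := by
    by_contra hb
    rw [hM b (not_lt.1 hb)] at h2
    rcases lt_or_ge a M with ha | ha
    · have := lt_of_mem_permsBelow hM ha
      omega
    · rw [hM a ha] at h2
      omega
  exact ⟨by simp only [Set.mem_ofPred_eq]; omega, hb⟩

theorem invCount_one : invCount 1 = 0 := by
  have : inversions 1 = ∅ := by
    ext ⟨a, b⟩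
    simp only [inversions, Equiv.Perm.one_apply, Set.mem_ofPred_eq, Set.mem_empty_iff_false,
      iff_false]
    omega
  rw [invCount, this, Set.ncard_empty]

/-- The inversions of `σ s_i` are `(i, i + 1)` and the inversions of `σ`, transported by `s_i`. -/
theorem invCount_mul_adj {σ : Equiv.Perm ℕ} (hσ : σ ∈ SInf) {i : ℕ} (h : σ i < σ (i + 1)) :
    invCount (σ * adj i) = invCount σ + 1 := by
  have key : inversions (σ * adj i) =
      insert (i, i + 1) ((fun p : ℕ × ℕ => (adj i p.1, adj i p.2)) '' inversions σ) := by
    ext ⟨a, b⟩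
    simp only [inversions, Set.mem_ofPred_eq, Equiv.Perm.mul_apply, Set.mem_insert_iff,
      Set.mem_image, Prod.mk.injEq, Prod.exists]
    constructor
    · rintro ⟨h1, h2⟩
      by_cases hab : a = i ∧ b = i + 1
      · exact Or.inl hab
      · exact Or.inr ⟨adj i a, adj i b, ⟨adj_lt_adj h1 hab, h2⟩, by simp, by simp⟩
    · rintro (⟨rfl, rfl⟩ | ⟨a', b', ⟨h1, h2⟩, rfl, rfl⟩)
      · simpa using h
      · refine ⟨adj_lt_adj h1 ?_, by simpa using h2⟩
        rintro ⟨rfl, rfl⟩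
        omega
  have hinj : Function.Injective (fun p : ℕ × ℕ => (adj i p.1, adj i p.2)) :=
    fun p p' hp => Prod.ext ((adj i).injective (Prod.ext_iff.1 hp).1)
      ((adj i).injective (Prod.ext_iff.1 hp).2)
  rw [invCount, key, Set.ncard_insert_of_notMem _ ((finite_inversions hσ).image _),
    Set.ncard_image_of_injective _ hinj, invCount]
  rintro ⟨⟨a, b⟩, ⟨h1, -⟩, h3⟩
  simp only [Prod.mk.injEq] at h1 h3
  have ha : a = i + 1 := by rw [← adj_adj i a, h3.1, adj_apply_left]
  have hb : b = i := by rw [← adj_adj i b, h3.2, adj_apply_right]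
  omega

theorem invCount_mul_adj_of_gt {σ : Equiv.Perm ℕ} (hσ : σ ∈ SInf) {i : ℕ}
    (h : σ (i + 1) < σ i) : invCount (σ * adj i) + 1 = invCount σ := by
  have h' : (σ * adj i) i < (σ * adj i) (i + 1) := by simpa using h
  rw [← invCount_mul_adj (mul_mem hσ (adj_mem_SInf i)) h', mul_adj_mul_adj]

theorem invCount_inv (σ : Equiv.Perm ℕ) : invCount σ⁻¹ = invCount σ := by
  have hinj : Function.Injective (fun p : ℕ × ℕ => (σ p.2, σ p.1)) :=
    fun p p' hp => Prod.ext (σ.injective (Prod.ext_iff.1 hp).2)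
      (σ.injective (Prod.ext_iff.1 hp).1)
  rw [invCount, invCount, ← Set.ncard_image_of_injective (inversions σ) hinj]
  congr 1
  ext ⟨a, b⟩
  simp only [inversions, Set.mem_ofPred_eq, Set.mem_image, Prod.mk.injEq, Prod.exists]
  constructor
  · rintro ⟨h1, h2⟩
    exact ⟨σ⁻¹ b, σ⁻¹ a, ⟨h2, by simpa using h1⟩, by simp, by simp⟩
  · rintro ⟨a', b', ⟨h1, h2⟩, rfl, rfl⟩
    exact ⟨h2, by simpa using h1⟩

theorem apply_ne_apply_succ (σ : Equiv.Perm ℕ) (i : ℕ) : σ i ≠ σ (i + 1) :=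
  fun h => by have := σ.injective h; omega

theorem exists_descent {σ : Equiv.Perm ℕ} (h : σ ≠ 1) : ∃ i, σ (i + 1) < σ i := by
  by_contra! hcon
  have hmono : StrictMono σ := strictMono_nat_of_lt_succ fun i =>
    lt_of_le_of_ne (hcon i) (apply_ne_apply_succ σ i)
  have hinv : StrictMono ⇑(σ⁻¹) := fun a b hab => by
    rw [← hmono.lt_iff_lt]; simpa using hab
  refine h (Equiv.ext fun k => le_antisymm ?_ (hmono.id_le k))
  simpa using hmono.monotone (hinv.id_le k)

/-- Induction along right multiplication by adjacent transpositions that increase the length,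
inside `S_M`. -/
theorem permsBelow_induction {M : ℕ} {P : Equiv.Perm ℕ → Prop} (one : P 1)
    (mul : ∀ σ i, σ ∈ permsBelow M → i + 1 < M → σ i < σ (i + 1) → P σ → P (σ * adj i))
    {σ : Equiv.Perm ℕ} (hσ : σ ∈ permsBelow M) : P σ := by
  induction h : invCount σ using Nat.strong_induction_on generalizing σ with
  | _ d ih =>
    by_cases h1 : σ = 1
    · exact h1 ▸ one
    obtain ⟨i, hi⟩ := exists_descent h1
    have hiM : i + 1 < M := by
      by_contra hcon
      rw [hσ (i + 1) (not_lt.1 hcon)] at hi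
      rcases lt_or_ge i M with hlt | hge
      · have := lt_of_mem_permsBelow hσ hlt
        omega
      · rw [hσ i hge] at hi
        omega
    have hmem := mul_mem hσ (adj_mem_permsBelow hiM)
    have hlen := invCount_mul_adj_of_gt (permsBelow_le_SInf M hσ) hi
    have := mul (σ * adj i) i hmem hiM (by simpa using hi) (ih _ (by omega) hmem rfl)
    rwa [mul_adj_mul_adj] at this

theorem prod_adj_mem_SInf (l : List ℕ) : (l.map adj).prod ∈ SInf :=
  list_prod_mem fun x hx => by
    obtain ⟨i, -, rfl⟩ := List.mem_map.1 hx
    exact adj_mem_SInf i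

theorem invCount_prod_le (l : List ℕ) : invCount (l.map adj).prod ≤ l.length := by
  induction l using List.reverseRecOn with
  | nil => simp [invCount_one]
  | append_singleton l i ih =>
    simp only [List.map_append, List.map_cons, List.map_nil, List.prod_append,
      List.prod_singleton, List.length_append, List.length_singleton]
    rcases lt_or_gt_of_ne (apply_ne_apply_succ (l.map adj).prod i) with h | h
    · rw [invCount_mul_adj (prod_adj_mem_SInf l) h]
      omega
    · have := invCount_mul_adj_of_gt (prod_adj_mem_SInf l) h
      omega

theorem exists_word_length_eq {σ : Equiv.Perm ℕ} (hσ : σ ∈ SInf) :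
    ∃ l : List ℕ, (l.map adj).prod = σ ∧ l.length = invCount σ := by
  obtain ⟨M, hM⟩ := exists_mem_permsBelow hσ
  refine permsBelow_induction (M := M)
    (P := fun σ => ∃ l : List ℕ, (l.map adj).prod = σ ∧ l.length = invCount σ)
    ⟨[], by simp [invCount_one]⟩ ?_ hM
  rintro σ i hσ - hi ⟨l, hl, hlen⟩
  exact ⟨l ++ [i], by simp [hl], by
    rw [invCount_mul_adj (permsBelow_le_SInf M hσ) hi]; simp [hlen]⟩

theorem isReducedWord_iff {σ : Equiv.Perm ℕ} (hσ : σ ∈ SInf) (l : List ℕ) :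
    IsReducedWord l σ ↔ (l.map adj).prod = σ ∧ l.length = invCount σ := by
  constructor
  · rintro ⟨h1, h2⟩
    obtain ⟨l', hl', hlen⟩ := exists_word_length_eq hσ
    have h3 := h2 l' hl'
    have h4 := invCount_prod_le l
    rw [h1] at h4
    exact ⟨h1, by omega⟩
  · rintro ⟨h1, h2⟩
    refine ⟨h1, fun l' hl' => ?_⟩
    have := invCount_prod_le l'
    rw [hl'] at this
    omega

/-! ### Independence of the reduced word -/

section Matsumoto

variable {R : Type*} [Monoid R] {T : ℕ → R}

/-- **Matsumoto's theorem** for `S_∞`: if the `T i` satisfy the braid relations, then the product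
of the `T i` along a reduced word only depends on the permutation. -/
theorem prod_map_eq_of_reduced
    (comm : ∀ i j, i + 2 ≤ j → T i * T j = T j * T i)
    (braid : ∀ i, T i * T (i + 1) * T i = T (i + 1) * T i * T (i + 1))
    {σ : Equiv.Perm ℕ} (hσ : σ ∈ SInf) {l l' : List ℕ}
    (hl : IsReducedWord l σ) (hl' : IsReducedWord l' σ) :
    (l.map T).prod = (l'.map T).prod := by
  rw [isReducedWord_iff hσ] at hl hl'
  obtain ⟨hp, hlen⟩ := hl
  obtain ⟨hp', hlen'⟩ := hl'
  induction hn : invCount σ using Nat.strong_induction_on generalizing σ l l' with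
  | _ d ih =>
  rcases List.eq_nil_or_concat l with rfl | ⟨a, i, rfl⟩
  · have : l' = [] := List.eq_nil_of_length_eq_zero (by rw [hlen', ← hlen]; rfl)
    rw [this]
  rcases List.eq_nil_or_concat l' with rfl | ⟨b, j, rfl⟩
  · simp at hlen'
    rw [← hlen'] at hlen
    simp at hlen
  simp only [List.concat_eq_append, List.map_append, List.map_cons, List.map_nil,
    List.prod_append, List.prod_singleton, List.length_append, List.length_singleton] at *
  have key : ∀ (a : List ℕ) (i : ℕ), (a.map adj).prod * adj i = σ → a.length + 1 = invCount σ →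
      (a.map adj).prod = σ * adj i ∧ a.length = invCount (σ * adj i) ∧ σ (i + 1) < σ i := by
    intro a i hp hlen
    have h1 : (a.map adj).prod = σ * adj i := by rw [← hp, mul_adj_mul_adj]
    have h2 := invCount_prod_le a
    rw [h1] at h2
    rcases lt_or_gt_of_ne (apply_ne_apply_succ σ i) with h | h
    · rw [invCount_mul_adj hσ h] at h2
      omega
    · have := invCount_mul_adj_of_gt hσ h
      exact ⟨h1, by omega, h⟩
  obtain ⟨ha, halen, hi⟩ := key a i hp hlen
  obtain ⟨hb, hblen, hj⟩ := key b j hp' hlen'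
  have hiS := mul_mem hσ (adj_mem_SInf i)
  have hjS := mul_mem hσ (adj_mem_SInf j)
  -- Two words with distinct last letters `i < j` are compared through words of `σ` that end in
  -- the longest element of the subgroup generated by these two letters.
  have main : ∀ (a b : List ℕ) (i j : ℕ), i < j →
      (a.map adj).prod = σ * adj i → a.length = invCount (σ * adj i) →
      (b.map adj).prod = σ * adj j → b.length = invCount (σ * adj j) →
      σ (i + 1) < σ i → σ (j + 1) < σ j →
      (a.map T).prod * T i = (b.map T).prod * T j := by
    intro a b i j hij ha halen hb hblen hi hj
    have hiS := mul_mem hσ (adj_mem_SInf i)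
    have hjS := mul_mem hσ (adj_mem_SInf j)
    have li := invCount_mul_adj_of_gt hσ hi
    have lj := invCount_mul_adj_of_gt hσ hj
    rcases Nat.lt_or_ge (i + 1) j with h2 | h2
    · have hd : (σ * adj i) (j + 1) < (σ * adj i) j := by
        simpa [adj_apply_of_ne (show j ≠ i by omega) (show j ≠ i + 1 by omega),
          adj_apply_of_ne (show j + 1 ≠ i by omega) (show j + 1 ≠ i + 1 by omega)] using hj
      have lij := invCount_mul_adj_of_gt hiS hd
      obtain ⟨c, hc, hclen⟩ := exists_word_length_eq (mul_mem hiS (adj_mem_SInf j))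
      have e1 : (a.map T).prod = ((c ++ [j]).map T).prod :=
        ih _ (by omega) hiS ha halen (by simp [hc, mul_adj_mul_adj])
          (by simp; omega) rfl
      have e2 : (b.map T).prod = ((c ++ [i]).map T).prod :=
        ih _ (by omega) hjS hb hblen
          (by simp [hc, mul_assoc]; rw [← adj_comm h2, ← mul_assoc, adj_mul_self, one_mul])
          (by simp; omega) rfl
      rw [e1, e2]
      simp [mul_assoc, comm i j h2]
    · obtain rfl : j = i + 1 := by omega
      have hd : (σ * adj i) (i + 1 + 1) < (σ * adj i) (i + 1) := by
        simpa [adj_apply_of_ne (show i + 1 + 1 ≠ i by omega)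
          (show i + 1 + 1 ≠ i + 1 by omega)] using hj.trans hi
      have l2 := invCount_mul_adj_of_gt hiS hd
      have hS2 := mul_mem hiS (adj_mem_SInf (i + 1))
      have hd' : (σ * adj i * adj (i + 1)) (i + 1) < (σ * adj i * adj (i + 1)) i := by
        simpa [adj_apply_of_ne (show i + 1 + 1 ≠ i by omega)
          (show i + 1 + 1 ≠ i + 1 by omega), adj_apply_of_ne (show i ≠ i + 1 by omega)
          (show i ≠ i + 1 + 1 by omega)] using hj
      have l3 := invCount_mul_adj_of_gt hS2 hd'
      obtain ⟨c, hc, hclen⟩ := exists_word_length_eq (mul_mem hS2 (adj_mem_SInf i))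
      have e1 : (a.map T).prod = ((c ++ [i, i + 1]).map T).prod :=
        ih _ (by omega) hiS ha halen (by
            simp only [List.map_append, List.map_cons, List.map_nil, List.prod_append, hc,
              List.prod_cons, List.prod_nil, mul_one]
            rw [← mul_assoc, mul_adj_mul_adj, mul_adj_mul_adj])
          (by simp; omega) rfl
      have e2 : (b.map T).prod = ((c ++ [i + 1, i]).map T).prod :=
        ih _ (by omega) hjS hb hblen (by
            simp only [List.map_append, List.map_cons, List.map_nil, List.prod_append, hc,
              List.prod_cons, List.prod_nil, mul_one]
            rw [mul_assoc σ, mul_assoc σ, adj_braid, ← mul_assoc, ← mul_assoc, ← mul_assoc,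
              mul_adj_mul_adj, mul_adj_mul_adj])
          (by simp; omega) rfl
      rw [e1, e2]
      simp only [List.map_append, List.map_cons, List.map_nil, List.prod_append,
        List.prod_cons, List.prod_nil, mul_one]
      have hb := braid i
      simp only [mul_assoc] at hb ⊢
      rw [hb]
  rcases lt_trichotomy i j with h | rfl | h
  · exact main a b i j h ha halen hb hblen hi hj
  · have hl := invCount_mul_adj_of_gt hσ hi
    rw [ih _ (by omega) hiS ha halen hb hblen rfl]
  · exact (main b a j i h hb hblen ha halen hj hi).symm

end Matsumoto

/-! ### The standard basis of the Hecke algebra and the symmetrizers -/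

section HeckeElements

variable {K : Type*} [Field K] {R : Type*} [Ring R] [Algebra K R]

/-- The elements `T i` of a `K`-algebra satisfy the relations of the Hecke algebra of `S_∞` with
the normalization `T² = (q² - 1) T + q²`. -/
structure IsHecke (q : K) (T : ℕ → R) : Prop where
  quad : ∀ i, T i * T i = (q ^ 2 - 1) • T i + (q ^ 2) • (1 : R)
  comm : ∀ i j, i + 2 ≤ j → T i * T j = T j * T i
  braid : ∀ i, T i * T (i + 1) * T i = T (i + 1) * T i * T (i + 1)

/-- The product of the `T i` along a reduced word of `σ`. -/
noncomputable def heckeElt {R : Type*} [Monoid R] (T : ℕ → R) (σ : SInf) : R :=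
  ((reducedWord σ).map T).prod

/-- The adjacent transposition, as an element of `S_∞`. -/
def adjS (i : ℕ) : SInf := ⟨adj i, adj_mem_SInf i⟩

theorem adjS_mul_adjS_mul (i : ℕ) (σ : SInf) : adjS i * (adjS i * σ) = σ := by
  apply Subtype.ext
  simp [adjS, ← mul_assoc]

variable {q : K} {T : ℕ → R}

theorem IsHecke.shift (h : IsHecke q T) : IsHecke q fun i => T (i + 1) where
  quad i := h.quad (i + 1)
  comm i j hij := h.comm (i + 1) (j + 1) (by omega)
  braid i := h.braid (i + 1)

theorem IsHecke.heckeElt_eq (h : IsHecke q T) {σ : SInf} {l : List ℕ}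
    (hl : (l.map adj).prod = (σ : Equiv.Perm ℕ)) (hlen : l.length = invCount σ) :
    heckeElt T σ = (l.map T).prod :=
  prod_map_eq_of_reduced h.comm h.braid σ.2 (isReducedWord_reducedWord σ)
    ((isReducedWord_iff σ.2 l).2 ⟨hl, hlen⟩)

theorem prod_reducedWord (σ : SInf) : ((reducedWord σ).map adj).prod = (σ : Equiv.Perm ℕ) :=
  ((isReducedWord_iff σ.2 _).1 (isReducedWord_reducedWord σ)).1

theorem length_reducedWord (σ : SInf) : (reducedWord σ).length = invCount σ :=
  ((isReducedWord_iff σ.2 _).1 (isReducedWord_reducedWord σ)).2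

theorem IsHecke.heckeElt_one (h : IsHecke q T) : heckeElt T 1 = 1 :=
  h.heckeElt_eq (l := []) rfl invCount_one.symm

theorem IsHecke.heckeElt_mul_adj (h : IsHecke q T) (σ : SInf) (i : ℕ)
    (hi : (σ : Equiv.Perm ℕ) i < (σ : Equiv.Perm ℕ) (i + 1)) :
    heckeElt T (σ * adjS i) = heckeElt T σ * T i := by
  rw [h.heckeElt_eq (l := reducedWord σ ++ [i])]
  · simp [heckeElt]
  · simp [prod_reducedWord, adjS]
  · simp only [List.length_append, List.length_singleton, length_reducedWord]
    exact (invCount_mul_adj σ.2 hi).symm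

theorem IsHecke.heckeElt_adj_mul (h : IsHecke q T) (σ : SInf) (i : ℕ)
    (hi : (σ : Equiv.Perm ℕ)⁻¹ i < (σ : Equiv.Perm ℕ)⁻¹ (i + 1)) :
    heckeElt T (adjS i * σ) = T i * heckeElt T σ := by
  rw [h.heckeElt_eq (l := i :: reducedWord σ)]
  · simp [heckeElt]
  · simp [prod_reducedWord, adjS]
  · have h1 := invCount_mul_adj (inv_mem σ.2) hi
    rw [invCount_inv] at h1
    rw [List.length_cons, length_reducedWord, ← h1, ← invCount_inv]
    simp [adjS]

theorem finite_permsBelow (M : ℕ) : {σ : SInf | (σ : Equiv.Perm ℕ) ∈ permsBelow M}.Finite := by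
  have h : Finite {f : Equiv.Perm ℕ // ∀ a, ¬ a < M → f a = a} :=
    Finite.of_equiv _ (Equiv.Perm.subtypeEquivSubtypePerm (· < M))
  refine Set.Finite.of_injOn (f := fun σ : SInf => (σ : Equiv.Perm ℕ))
    (t := {f : Equiv.Perm ℕ | ∀ a, ¬ a < M → f a = a})
    (fun σ hσ a ha => hσ a (not_lt.1 ha)) (fun σ _ τ _ hστ => Subtype.ext hστ) h

/-- The finite set of the permutations in `S_M ⊂ S_∞`. -/
noncomputable def permsFinset (M : ℕ) : Finset SInf := (finite_permsBelow M).toFinset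

theorem mem_permsFinset {M : ℕ} {σ : SInf} :
    σ ∈ permsFinset M ↔ (σ : Equiv.Perm ℕ) ∈ permsBelow M := by
  simp [permsFinset]

/-- The symmetrizer `∑_{σ ∈ S_M} T_σ`. -/
noncomputable def symmetrizer (T : ℕ → R) (M : ℕ) : R := ∑ σ ∈ permsFinset M, heckeElt T σ

/-- The symmetrizer is divisible by `1 + T i` on the left: the permutations come in pairs
`σ, s_i σ`. -/
theorem IsHecke.exists_symmetrizer_eq (h : IsHecke q T) {i M : ℕ} (hi : i + 1 < M) :
    ∃ X, symmetrizer T M = (1 + T i) * X := by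
  classical
  let asc : SInf → Prop := fun σ => (σ : Equiv.Perm ℕ)⁻¹ i < (σ : Equiv.Perm ℕ)⁻¹ (i + 1)
  have hflip : ∀ σ : SInf, asc (adjS i * σ) ↔ ¬ asc σ := by
    intro σ
    have := apply_ne_apply_succ (σ : Equiv.Perm ℕ)⁻¹ i
    simp only [asc, adjS, Subgroup.coe_mul, mul_inv_rev, adj_inv, Equiv.Perm.mul_apply,
      adj_apply_left, adj_apply_right]
    omega
  have hmem : ∀ σ : SInf, σ ∈ permsFinset M → adjS i * σ ∈ permsFinset M := fun σ hσ =>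
    mem_permsFinset.2 (mul_mem (adj_mem_permsBelow hi) (mem_permsFinset.1 hσ))
  refine ⟨∑ σ ∈ (permsFinset M).filter asc, heckeElt T σ, ?_⟩
  rw [symmetrizer, ← Finset.sum_filter_add_sum_filter_not _ asc, add_mul, one_mul]
  congr 1
  rw [Finset.mul_sum]
  symm
  refine Finset.sum_bij' (fun σ _ => adjS i * σ) (fun σ _ => adjS i * σ) ?_ ?_ ?_ ?_ ?_
  · intro σ hσ
    rw [Finset.mem_filter] at hσ ⊢
    exact ⟨hmem σ hσ.1, fun hcon => (hflip σ).1 hcon hσ.2⟩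
  · intro σ hσ
    rw [Finset.mem_filter] at hσ ⊢
    exact ⟨hmem σ hσ.1, (hflip σ).2 hσ.2⟩
  · intro σ _
    exact adjS_mul_adjS_mul i σ
  · intro σ _
    exact adjS_mul_adjS_mul i σ
  · intro σ hσ
    exact (h.heckeElt_adj_mul σ i (Finset.mem_filter.1 hσ).2).symm

theorem IsHecke.mul_symmetrizer (h : IsHecke q T) {i M : ℕ} (hi : i + 1 < M) :
    T i * symmetrizer T M = q ^ 2 • symmetrizer T M := by
  obtain ⟨X, hX⟩ := h.exists_symmetrizer_eq hi
  rw [hX, ← mul_assoc, ← smul_mul_assoc]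
  congr 1
  rw [mul_add, mul_one, h.quad i]
  module

/-- The permutation `σ` acting on the positions `1, 2, …`. -/
noncomputable def shiftPerm : Equiv.Perm ℕ →* Equiv.Perm ℕ :=
  Equiv.Perm.viaEmbeddingHom ⟨Nat.succ, Nat.succ_injective⟩

@[simp] theorem shiftPerm_succ (σ : Equiv.Perm ℕ) (k : ℕ) :
    shiftPerm σ (k + 1) = σ k + 1 :=
  Equiv.Perm.viaEmbedding_apply σ ⟨Nat.succ, Nat.succ_injective⟩ k

@[simp] theorem shiftPerm_zero (σ : Equiv.Perm ℕ) : shiftPerm σ 0 = 0 :=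
  Equiv.Perm.viaEmbedding_apply_of_notMem σ ⟨Nat.succ, Nat.succ_injective⟩ 0 (by simp)

theorem shiftPerm_adj (i : ℕ) : shiftPerm (adj i) = adj (i + 1) := by
  ext k
  rcases k with - | k
  · simp [adj_apply_of_ne]
  · simp only [shiftPerm_succ, adj, Equiv.swap_apply_def]
    split_ifs <;> omega

theorem shiftPerm_mem {M : ℕ} {σ : Equiv.Perm ℕ} (hσ : σ ∈ permsBelow M) :
    shiftPerm σ ∈ permsBelow (M + 1) := by
  rintro (- | k) hk
  · simp
  · rw [shiftPerm_succ, hσ k (by omega)]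

/-- `shiftPerm` on `S_∞`. -/
noncomputable def shiftS (σ : SInf) : SInf :=
  ⟨shiftPerm σ, by
    obtain ⟨M, hM⟩ := exists_mem_permsBelow σ.2
    exact permsBelow_le_SInf _ (shiftPerm_mem hM)⟩

theorem shiftS_injective : Function.Injective shiftS := fun _ _ h =>
  Subtype.ext (Equiv.Perm.viaEmbeddingHom_injective _ (Subtype.ext_iff.1 h))

theorem exists_shiftS_eq {M : ℕ} {σ : SInf} (hσ : (σ : Equiv.Perm ℕ) ∈ permsBelow (M + 1))
    (h0 : (σ : Equiv.Perm ℕ) 0 = 0) :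
    ∃ τ : SInf, (τ : Equiv.Perm ℕ) ∈ permsBelow M ∧ shiftS τ = σ := by
  have pos : ∀ ρ : Equiv.Perm ℕ, ρ 0 = 0 → ∀ k, ρ (k + 1) - 1 + 1 = ρ (k + 1) := by
    intro ρ hρ k
    have : ρ (k + 1) ≠ 0 := fun hk => by
      rw [← hρ] at hk
      exact absurd (ρ.injective hk) (by omega)
    omega
  have h0' : (σ : Equiv.Perm ℕ)⁻¹ 0 = 0 := by rw [Equiv.Perm.inv_eq_iff_eq, h0]
  let τ : Equiv.Perm ℕ :=
    { toFun := fun k => (σ : Equiv.Perm ℕ) (k + 1) - 1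
      invFun := fun k => (σ : Equiv.Perm ℕ)⁻¹ (k + 1) - 1
      left_inv := fun k => by
        simp only
        rw [pos _ h0]; simp
      right_inv := fun k => by
        simp only
        rw [pos _ h0']; simp }
  have hτ : τ ∈ permsBelow M := fun k hk => by
    change (σ : Equiv.Perm ℕ) (k + 1) - 1 = k
    rw [hσ (k + 1) (by omega)]
    rfl
  refine ⟨⟨τ, permsBelow_le_SInf M hτ⟩, hτ, Subtype.ext (Equiv.ext ?_)⟩
  rintro (- | k)
  · exact (shiftPerm_zero τ).trans h0.symm
  · exact (shiftPerm_succ τ k).trans (pos _ h0 k)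

theorem IsHecke.heckeElt_shiftS (h : IsHecke q T) (σ : SInf) :
    heckeElt T (shiftS σ) = heckeElt (fun i => T (i + 1)) σ := by
  obtain ⟨M, hM⟩ := exists_mem_permsBelow σ.2
  have key : ∀ σ : Equiv.Perm ℕ, σ ∈ permsBelow M → ∀ hσ : σ ∈ SInf,
      heckeElt T (shiftS ⟨σ, hσ⟩) = heckeElt (fun i => T (i + 1)) ⟨σ, hσ⟩ := by
    intro σ hσ
    refine permsBelow_induction (M := M) (P := fun σ => ∀ hσ : σ ∈ SInf,
      heckeElt T (shiftS ⟨σ, hσ⟩) = heckeElt (fun i => T (i + 1)) ⟨σ, hσ⟩) ?_ ?_ hσ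
    · intro h1
      have e1 : (⟨1, h1⟩ : SInf) = 1 := rfl
      have e2 : shiftS 1 = 1 := Subtype.ext (map_one shiftPerm)
      rw [e1, e2, h.heckeElt_one, h.shift.heckeElt_one]
    · rintro σ i hσ - hi ih hS
      have hσS := permsBelow_le_SInf M hσ
      have e1 : (⟨σ * adj i, hS⟩ : SInf) = ⟨σ, hσS⟩ * adjS i := rfl
      have e2 : shiftS (⟨σ, hσS⟩ * adjS i) = shiftS ⟨σ, hσS⟩ * adjS (i + 1) :=
        Subtype.ext (by
          change shiftPerm (σ * adj i) = shiftPerm σ * adj (i + 1)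
          rw [map_mul, shiftPerm_adj])
      rw [e1, e2, h.heckeElt_mul_adj, h.shift.heckeElt_mul_adj _ _ hi, ih hσS]
      change shiftPerm σ (i + 1) < shiftPerm σ (i + 1 + 1)
      simpa using hi
  exact key σ hM σ.2

/-- The product `T_{r-1} ⋯ T_1 T_0`, which moves the factor at position `r` to the front. -/
def drag (T : ℕ → R) : ℕ → R
  | 0 => 1
  | r + 1 => T r * drag T r

/-- The symmetrizer splits along the cosets of the stabilizer of the position `0`. -/
theorem IsHecke.symmetrizer_succ (h : IsHecke q T) (M : ℕ) :
    symmetrizer T (M + 1) =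
      (∑ r ∈ Finset.range (M + 1), drag T r) * symmetrizer (fun i => T (i + 1)) M := by
  classical
  let fib : ℕ → Finset SInf := fun r =>
    (permsFinset (M + 1)).filter fun σ => (σ : Equiv.Perm ℕ) 0 = r
  have mem_fib : ∀ r σ, σ ∈ fib r ↔
      (σ : Equiv.Perm ℕ) ∈ permsBelow (M + 1) ∧ (σ : Equiv.Perm ℕ) 0 = r := by
    intro r σ
    rw [Finset.mem_filter, mem_permsFinset]
  have h0 : ∑ σ ∈ fib 0, heckeElt T σ = symmetrizer (fun i => T (i + 1)) M := by
    symm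
    refine Finset.sum_bij (fun σ _ => shiftS σ) ?_ ?_ ?_ ?_
    · intro σ hσ
      exact (mem_fib _ _).2 ⟨shiftPerm_mem (mem_permsFinset.1 hσ), shiftPerm_zero _⟩
    · intro σ _ τ _ hστ
      exact shiftS_injective hστ
    · intro σ hσ
      obtain ⟨τ, hτ, rfl⟩ := exists_shiftS_eq ((mem_fib _ _).1 hσ).1 ((mem_fib _ _).1 hσ).2
      exact ⟨τ, mem_permsFinset.2 hτ, rfl⟩
    · intro σ _
      exact (h.heckeElt_shiftS σ).symm
  have hsucc : ∀ r, r < M →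
      ∑ σ ∈ fib (r + 1), heckeElt T σ = T r * ∑ σ ∈ fib r, heckeElt T σ := by
    intro r hr
    rw [Finset.mul_sum]
    symm
    refine Finset.sum_bij' (fun σ _ => adjS r * σ) (fun σ _ => adjS r * σ) ?_ ?_ ?_ ?_ ?_
    · intro σ hσ
      rw [mem_fib] at hσ ⊢
      refine ⟨mul_mem (adj_mem_permsBelow (by omega)) hσ.1, ?_⟩
      simp [adjS, hσ.2]
    · intro σ hσ
      rw [mem_fib] at hσ ⊢
      refine ⟨mul_mem (adj_mem_permsBelow (by omega)) hσ.1, ?_⟩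
      simp [adjS, hσ.2]
    · intro σ _
      exact adjS_mul_adjS_mul r σ
    · intro σ _
      exact adjS_mul_adjS_mul r σ
    · intro σ hσ
      rw [mem_fib] at hσ
      have e : (σ : Equiv.Perm ℕ)⁻¹ r = 0 := by rw [Equiv.Perm.inv_eq_iff_eq, hσ.2]
      refine (h.heckeElt_adj_mul σ r ?_).symm
      rw [e]
      refine Nat.pos_of_ne_zero fun hcon => ?_
      rw [Equiv.Perm.inv_eq_iff_eq, hσ.2] at hcon
      omega
  have hfib : ∀ r, r ≤ M →
      ∑ σ ∈ fib r, heckeElt T σ = drag T r * symmetrizer (fun i => T (i + 1)) M := by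
    intro r
    induction r with
    | zero => intro _; rw [h0, drag, one_mul]
    | succ r ih => intro hr; rw [hsucc r (by omega), ih (by omega), drag, mul_assoc]
  rw [Finset.sum_mul, symmetrizer, ← Finset.sum_fiberwise_of_maps_to (t := Finset.range (M + 1))
    (g := fun σ : SInf => (σ : Equiv.Perm ℕ) 0)]
  · exact Finset.sum_congr rfl fun r hr => hfib r (by
      rw [Finset.mem_range] at hr
      omega)
  · intro σ hσ
    exact Finset.mem_range.2 (lt_of_mem_permsBelow (mem_permsFinset.1 hσ) (by omega))

end HeckeElements

/-! ### The relations of Demazure–Lusztig operators -/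

section DemazureLusztig
variable {F P : Type*} [Field F]

/-- A vector-valued Demazure–Lusztig operator over a field `F`: `s` exchanges the variables `x` and
`y`, `P` is the set of sequences `m` of labels, `σ` exchanges the labels `a m` and `b m`, and `g m`
is the coefficient of `m`. The action of `T_i` takes this form once the quotients
by `z_i - z_{i+1}` are formed in the field of fractions of the Laurent polynomials. -/
def demazureLusztig (q : F) (s : F →+* F) (x y : F) (σ : P → P) (a b : P → Fin 2) (g : P → F) :
    P → F := fun m =>
  -((if a m = b m then 1 else q) * s (g (σ m))) -
    (q ^ 2 - 1) * (((if a m < b m then y else x) * s (g m) - x * g m) / (x - y))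

theorem demazureLusztig_quad {q : F} {s : F →+* F} {x y : F} {σ : P → P} {a b : P → Fin 2}
    (hq : s q = q) (hx : s x = y) (hy : s y = x) (hxy : x ≠ y)
    (hs : ∀ f, s (s f) = f) (hσ : ∀ m, σ (σ m) = m) (ha : ∀ m, a (σ m) = b m)
    (hb : ∀ m, b (σ m) = a m) (hab : ∀ m, a m = b m → σ m = m) (g : P → F) (m : P) :
    demazureLusztig q s x y σ a b (demazureLusztig q s x y σ a b g) m =
      (q ^ 2 - 1) * demazureLusztig q s x y σ a b g m + q ^ 2 * g m := by
  have h1 : x - y ≠ 0 := sub_ne_zero.2 hxy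
  have h2 : y - x ≠ 0 := sub_ne_zero.2 hxy.symm
  simp only [demazureLusztig, map_sub, map_neg, map_mul, map_div₀, map_pow, map_one, apply_ite s,
    hq, hx, hy, hs, hσ, ha, hb]
  rw [← neg_sub x y]
  rcases lt_trichotomy (a m) (b m) with h | h | h
  · simp only [h, h.ne, h.ne', h.not_gt, if_true, if_false]
    field_simp
    ring
  · rw [hab m h]
    simp only [h, lt_irrefl, if_true, if_false]
    field_simp
    ring
  · simp only [h, h.ne, h.ne', h.not_gt, if_true, if_false]
    field_simp
    ring

theorem demazureLusztig_comm {q : F} {s t : F →+* F} {x y z w : F} {σ τ : P → P}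
    {a b c d : P → Fin 2}
    (hsq : s q = q) (htq : t q = q) (hsz : s z = z) (hsw : s w = w) (htx : t x = x)
    (hty : t y = y) (hst : ∀ f, t (s f) = s (t f)) (hστ : ∀ m, τ (σ m) = σ (τ m))
    (ha : ∀ m, a (τ m) = a m) (hb : ∀ m, b (τ m) = b m)
    (hc : ∀ m, c (σ m) = c m) (hd : ∀ m, d (σ m) = d m) (g : P → F) :
    demazureLusztig q s x y σ a b (demazureLusztig q t z w τ c d g) =
      demazureLusztig q t z w τ c d (demazureLusztig q s x y σ a b g) := by
  funext m
  simp only [demazureLusztig, map_sub, map_neg, map_mul, map_div₀, map_pow, map_one,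
    apply_ite s, apply_ite t, hsq, htq, hsz, hsw, htx, hty, hst, hστ, ha, hb, hc, hd]
  ring

/-- The braid relation, checked for each of the eight patterns of labels at three consecutive
positions. Labels that coincide identify some of the permuted sequences. -/
theorem demazureLusztig_braid {q : F} {s t : F →+* F} {x y z : F} {σ τ : P → P}
    {a b c : P → Fin 2}
    (hsq : s q = q) (htq : t q = q) (hsx : s x = y) (hsy : s y = x) (hsz : s z = z)
    (htx : t x = x) (hty : t y = z) (htz : t z = y) (hxy : x ≠ y) (hxz : x ≠ z) (hyz : y ≠ z)
    (hs : ∀ f, s (s f) = f) (ht : ∀ f, t (t f) = f) (hst : ∀ f, t (s (t f)) = s (t (s f)))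
    (hσ : ∀ m, σ (σ m) = m) (hτ : ∀ m, τ (τ m) = m) (hστ : ∀ m, τ (σ (τ m)) = σ (τ (σ m)))
    (haσ : ∀ m, a (σ m) = b m) (hbσ : ∀ m, b (σ m) = a m) (hcσ : ∀ m, c (σ m) = c m)
    (haτ : ∀ m, a (τ m) = a m) (hbτ : ∀ m, b (τ m) = c m) (hcτ : ∀ m, c (τ m) = b m)
    (hab : ∀ m, a m = b m → σ m = m) (hbc : ∀ m, b m = c m → τ m = m) (g : P → F) :
    demazureLusztig q s x y σ a b (demazureLusztig q t y z τ b c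
      (demazureLusztig q s x y σ a b g)) =
    demazureLusztig q t y z τ b c (demazureLusztig q s x y σ a b
      (demazureLusztig q t y z τ b c g)) := by
  funext m
  have h1 : x - y ≠ 0 := sub_ne_zero.2 hxy
  have h2 : x - z ≠ 0 := sub_ne_zero.2 hxz
  have h3 : y - z ≠ 0 := sub_ne_zero.2 hyz
  simp only [demazureLusztig, map_sub, map_neg, map_mul, map_div₀, map_pow, map_one,
    apply_ite s, apply_ite t, hsq, htq, hsx, hsy, hsz, htx, hty, htz, hs, ht, hst, hσ, hτ, hστ,
    haσ, hbσ, hcσ, haτ, hbτ, hcτ, ← neg_sub x y, ← neg_sub y z]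
  have two : ∀ k : Fin 2, k = 0 ∨ k = 1 := by decide
  have f01 : (0 : Fin 2) ≠ 1 := by decide
  have f10 : (1 : Fin 2) ≠ 0 := by decide
  have l01 : (0 : Fin 2) < 1 := by decide
  have l10 : ¬ (1 : Fin 2) < 0 := by decide
  rcases two (a m) with ha | ha <;> rcases two (b m) with hb | hb <;>
    rcases two (c m) with hc | hc <;>
    simp only [ha, hb, hc, f01, f10, l01, l10, lt_irrefl, if_true, if_false] 
  · have e1 := hab m (ha.trans hb.symm)
    have e2 := hbc m (hb.trans hc.symm)
    simp only [e1, e2]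
    field_simp
    ring
  · have e1 := hab m (ha.trans hb.symm)
    simp only [e1]
    field_simp
    ring
  · have e1 := hbc (σ m) (by rw [hbσ, hcσ, ha, hc])
    have e2 := hab (τ m) (by rw [haτ, hbτ, ha, hc])
    simp only [e1, e2, hσ]
    field_simp
    ring
  · have e1 := hbc m (hb.trans hc.symm)
    have e2 := (hστ m).symm
    rw [e1] at e2
    simp only [e1, e2]
    field_simp
    ring
  · have e1 := hbc m (hb.trans hc.symm)
    have e2 := (hστ m).symm
    rw [e1] at e2
    simp only [e1, e2]
    field_simp
    ring
  · have e1 := hbc (σ m) (by rw [hbσ, hcσ, ha, hc])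
    have e2 := hab (τ m) (by rw [haτ, hbτ, ha, hc])
    simp only [e1, e2, hσ]
    field_simp
    ring
  · have e1 := hab m (ha.trans hb.symm)
    simp only [e1]
    field_simp
    ring
  · have e1 := hab m (ha.trans hb.symm)
    have e2 := hbc m (hb.trans hc.symm)
    simp only [e1, e2]
    field_simp
    ring

end DemazureLusztig

/-! ### The braid relations -/

section LaurentField

variable (K : Type*) [Field K]

/-- The ring of Laurent polynomials in `z_1, z_2, …` over `K`, in which infinite Laurent monomials
are allowed. -/
abbrev LaurentRing : Type _ := AddMonoidAlgebra K (ℕ → ℤ)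

/-- The field of fractions of `LaurentRing K`. -/
abbrev LaurentField : Type _ := FractionRing (LaurentRing K)

variable {K}

/-- The Laurent monomial with the exponents `d`. -/
noncomputable def monomialX (d : ℕ → ℤ) : LaurentField K :=
  algebraMap (LaurentRing K) (LaurentField K) (AddMonoidAlgebra.single d 1)

theorem monomialX_add (d e : ℕ → ℤ) :
    (monomialX (d + e) : LaurentField K) = monomialX d * monomialX e := by
  rw [monomialX, monomialX, monomialX, ← map_mul, AddMonoidAlgebra.single_mul_single, one_mul]

theorem monomialX_injective :
    Function.Injective (monomialX : (ℕ → ℤ) → LaurentField K) := by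
  intro d e h
  have h1 := IsFractionRing.injective (LaurentRing K) (LaurentField K) h
  exact AddMonoidAlgebra.single_left_injective one_ne_zero h1

/-- The exchange of the exponents at the positions `i` and `i + 1`. -/
def swapExp (i : ℕ) : (ℕ → ℤ) ≃+ (ℕ → ℤ) where
  toFun d := d ∘ adj i
  invFun d := d ∘ adj i
  left_inv d := by funext k; simp
  right_inv d := by funext k; simp
  map_add' _ _ := rfl

variable (K) in
/-- The automorphism of the field of fractions that exchanges `z_i` and `z_{i+1}`. -/
noncomputable def swapX (i : ℕ) : LaurentField K →+* LaurentField K :=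
  (IsFractionRing.ringEquivOfRingEquiv (A := LaurentRing K) (K := LaurentField K)
    (AddMonoidAlgebra.mapDomainRingEquiv K (swapExp i))).toRingHom

theorem swapX_algebraMap' (i : ℕ) (p : LaurentRing K) :
    swapX K i (algebraMap (LaurentRing K) (LaurentField K) p) =
      algebraMap (LaurentRing K) (LaurentField K)
        (AddMonoidAlgebra.mapDomainRingEquiv K (swapExp i) p) :=
  IsFractionRing.ringEquivOfRingEquiv_algebraMap _ _

theorem swapX_monomialX (i : ℕ) (d : ℕ → ℤ) :
    swapX K i (monomialX d) = monomialX (d ∘ adj i) := by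
  rw [monomialX, swapX_algebraMap', AddMonoidAlgebra.mapDomainRingEquiv_single]
  rfl

theorem algebraMap_eq_single (c : K) :
    algebraMap K (LaurentField K) c =
      algebraMap (LaurentRing K) (LaurentField K) (AddMonoidAlgebra.single 0 c) := by
  rw [IsScalarTower.algebraMap_apply K (LaurentRing K) (LaurentField K)]
  rfl

theorem swapX_algebraMap (i : ℕ) (c : K) :
    swapX K i (algebraMap K (LaurentField K) c) = algebraMap K (LaurentField K) c := by
  rw [algebraMap_eq_single, swapX_algebraMap', AddMonoidAlgebra.mapDomainRingEquiv_single,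
    map_zero]

theorem ringHom_ext_monomialX {f g : LaurentField K →+* LaurentField K}
    (h1 : ∀ c : K, f (algebraMap K _ c) = g (algebraMap K _ c))
    (h2 : ∀ d, f (monomialX d) = g (monomialX d)) : f = g := by
  refine IsFractionRing.ringHom_ext (A := LaurentRing K) fun p => ?_
  have : f.comp (algebraMap (LaurentRing K) (LaurentField K)) =
      g.comp (algebraMap (LaurentRing K) (LaurentField K)) :=
    AddMonoidAlgebra.ringHom_ext
      (fun c => by simpa only [algebraMap_eq_single, RingHom.comp_apply] using h1 c) (fun d => h2 d)
  exact RingHom.congr_fun this p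

theorem swapX_swapX (i : ℕ) (f : LaurentField K) : swapX K i (swapX K i f) = f := by
  have : (swapX K i).comp (swapX K i) = RingHom.id _ := by
    refine ringHom_ext_monomialX (fun c => ?_) fun d => ?_
    · simp [swapX_algebraMap]
    · simp only [RingHom.comp_apply, swapX_monomialX, RingHom.id_apply]
      congr 1
      funext k
      simp
  exact RingHom.congr_fun this f

theorem swapX_comm {i j : ℕ} (h : i + 2 ≤ j) (f : LaurentField K) :
    swapX K j (swapX K i f) = swapX K i (swapX K j f) := by
  have : (swapX K j).comp (swapX K i) = (swapX K i).comp (swapX K j) := by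
    refine ringHom_ext_monomialX (fun c => ?_) fun d => ?_
    · simp [swapX_algebraMap]
    · simp only [RingHom.comp_apply, swapX_monomialX]
      congr 1
      funext k
      exact congrArg d (Equiv.congr_fun (adj_comm h) k)
  exact RingHom.congr_fun this f

theorem swapX_braid (i : ℕ) (f : LaurentField K) :
    swapX K (i + 1) (swapX K i (swapX K (i + 1) f)) =
      swapX K i (swapX K (i + 1) (swapX K i f)) := by
  have : (swapX K (i + 1)).comp ((swapX K i).comp (swapX K (i + 1))) =
      (swapX K i).comp ((swapX K (i + 1)).comp (swapX K i)) := by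
    refine ringHom_ext_monomialX (fun c => ?_) fun d => ?_
    · simp [swapX_algebraMap]
    · simp only [RingHom.comp_apply, swapX_monomialX]
      congr 1
      funext k
      exact congrArg d (Equiv.congr_fun (adj_braid i).symm k)
  exact RingHom.congr_fun this f

/-- The variable `z_i`, as an element of the field of fractions. -/
noncomputable def varX (i : ℕ) : LaurentField K := monomialX (Pi.single i 1)

theorem varX_ne {i j : ℕ} (h : i ≠ j) : (varX i : LaurentField K) ≠ varX j := by
  intro hij
  have := congrFun (monomialX_injective hij) i
  simp [Pi.single_eq_of_ne h] at this

theorem swapX_varX (i j : ℕ) : swapX K i (varX j) = varX (adj i j) := by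
  rw [varX, swapX_monomialX, varX]
  congr 1
  funext k
  simp only [Function.comp_apply, Pi.single_apply]
  congr 1
  rw [eq_iff_iff]
  exact ⟨fun h => by rw [← h, adj_adj], fun h => by rw [h, adj_adj]⟩

/-- The coefficient functions of a finite combination of pure tensors: to a sequence
`m = (m_1, m_2, …)` belongs the Laurent polynomial with which `v_{m_1} ⊗ v_{m_2} ⊗ ⋯` is
multiplied. -/
noncomputable def realize : (PureTensor 2 →₀ K) →ₗ[K] ((ℕ → Fin 2) → LaurentField K) where
  toFun x m := algebraMap (LaurentRing K) (LaurentField K)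
    (.ofCoeff (Finsupp.lcomapDomain (R := K) (fun (d : ℕ → ℤ) k => ((d k, m k) : Label 2))
      (fun d e h => funext fun k => (Prod.ext_iff.1 (congrFun h k)).1) x))
  map_add' x y := by
    funext m
    rw [map_add, AddMonoidAlgebra.ofCoeff_add, map_add]
    rfl
  map_smul' c x := by
    funext m
    rw [map_smul, AddMonoidAlgebra.ofCoeff_smul, algebraMap.smul]
    rfl

theorem realize_injective : Function.Injective (realize (K := K)) := by
  intro x y h
  ext t
  have h1 := IsFractionRing.injective (LaurentRing K) (LaurentField K)
    (congrFun h fun k => (t k).2)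
  exact DFunLike.congr_fun (AddMonoidAlgebra.ofCoeff_injective h1) fun k => (t k).1

open Classical in
theorem realize_single (t : PureTensor 2) (c : K) (m : ℕ → Fin 2) :
    realize (Finsupp.single t c) m =
      if m = (fun k => (t k).2) then
        algebraMap K (LaurentField K) c * monomialX (fun k => (t k).1) else 0 := by
  have hinj : Function.Injective (fun (d : ℕ → ℤ) k => ((d k, m k) : Label 2)) :=
    fun d e h => funext fun k => (Prod.ext_iff.1 (congrFun h k)).1
  have hr : realize (Finsupp.single t c) m = algebraMap (LaurentRing K) (LaurentField K)
    (.ofCoeff (Finsupp.comapDomain (fun (d : ℕ → ℤ) k => ((d k, m k) : Label 2))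
      (Finsupp.single t c) hinj.injOn)) := rfl
  rw [hr]
  split_ifs with h
  · have ht : t = (fun (d : ℕ → ℤ) k => ((d k, m k) : Label 2)) (fun k => (t k).1) := by
      funext k
      rw [h]
    conv_lhs => rw [ht]
    rw [Finsupp.comapDomain_single, algebraMap_eq_single, monomialX, ← map_mul,
      AddMonoidAlgebra.single_mul_single, zero_add, mul_one]
    rfl
  · have : Finsupp.comapDomain (fun (d : ℕ → ℤ) k => ((d k, m k) : Label 2))
        (Finsupp.single t c) hinj.injOn = 0 := by
      ext d
      rw [Finsupp.comapDomain_apply, Finsupp.single_apply, if_neg]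
      · rfl
      · rintro rfl
        exact h rfl
    rw [this]
    exact map_zero _

/-- The substitution of `z_i, z_{i+1}` for the two variables of a Laurent polynomial. -/
noncomputable def evalX (i : ℕ) : AddMonoidAlgebra K (ℤ × ℤ) →+* LaurentField K :=
  (algebraMap (LaurentRing K) (LaurentField K)).comp
    (AddMonoidAlgebra.mapDomainRingHom K
      ((AddMonoidHom.single (fun _ : ℕ => ℤ) i).coprod
        (AddMonoidHom.single (fun _ : ℕ => ℤ) (i + 1))))

theorem evalX_single (i : ℕ) (a b : ℤ) (c : K) :
    evalX i (AddMonoidAlgebra.single (a, b) c) =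
      algebraMap K (LaurentField K) c * monomialX (Pi.single i a + Pi.single (i + 1) b) := by
  rw [algebraMap_eq_single, monomialX, ← map_mul,
      AddMonoidAlgebra.single_mul_single, zero_add, mul_one]
  simp [evalX]

theorem evalX_mono (i : ℕ) (a b : ℤ) :
    evalX i (mono K a b) = monomialX (Pi.single i a + Pi.single (i + 1) b) := by
  rw [mono, evalX_single, map_one, one_mul]

/-- The pure tensor `t` with its factors at the positions `i` and `i + 1` replaced. -/
def replaceTwo (i : ℕ) (t : PureTensor 2) (p : Label 2 × Label 2) : PureTensor 2 :=
  Function.update (Function.update t i p.1) (i + 1) p.2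

theorem heckeT_single (q : K) (i : ℕ) (t : PureTensor 2) (c : K) :
    heckeT q i (Finsupp.single t c) =
      c • (localT q (t i) (t (i + 1))).mapDomain (replaceTwo i t) := by
  rw [heckeT, Finsupp.linearCombination_single]
  rfl

theorem attach_add (m l : Fin 2) (P Q : AddMonoidAlgebra K (ℤ × ℤ)) :
    attach m l (P + Q) = attach m l P + attach m l Q := by
  simp [attach, Finsupp.mapDomain_add]

open Classical in
theorem realize_attach (i : ℕ) (t : PureTensor 2) (m l : Fin 2)
    (P : AddMonoidAlgebra K (ℤ × ℤ)) (μ : ℕ → Fin 2) :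
    realize ((attach m l P).mapDomain (replaceTwo i t)) μ =
      if μ = Function.update (Function.update (fun k => (t k).2) i m) (i + 1) l then
        evalX i P *
          monomialX (Function.update (Function.update (fun k => (t k).1) i 0) (i + 1) 0)
      else 0 := by
  induction P using AddMonoidAlgebra.induction_linear with
  | zero => simp [attach]
  | add P Q hP hQ =>
    rw [attach_add, Finsupp.mapDomain_add, map_add, Pi.add_apply, hP, hQ, map_add]
    split_ifs
    · rw [add_mul]
    · rw [add_zero]
  | single e c =>
    obtain ⟨a, b⟩ := e
    have h1 : attach m l (AddMonoidAlgebra.single (a, b) c) =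
        Finsupp.single (((a, m), (b, l)) : Label 2 × Label 2) c := by
      simp [attach]
    have h2 : (fun k => (replaceTwo i t ((a, m), (b, l)) k).2) =
        Function.update (Function.update (fun k => (t k).2) i m) (i + 1) l := by
      funext k
      simp only [replaceTwo, Function.update_apply]
      split_ifs <;> rfl
    have h3 : (fun k => (replaceTwo i t ((a, m), (b, l)) k).1) =
        (Pi.single i a + Pi.single (i + 1) b) +
          Function.update (Function.update (fun k => (t k).1) i 0) (i + 1) 0 := by
      funext k
      simp only [replaceTwo, Function.update_apply, Pi.add_apply, Pi.single_apply]
      split_ifs <;> simp_all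
    rw [h1, Finsupp.mapDomain_single, realize_single, h2, h3, evalX_single, monomialX_add]
    simp only [mul_assoc]

/-- The Hecke operator at the positions `i` and `i + 1` on coefficient functions. -/
noncomputable def heckeX (q : K) (i : ℕ) (g : (ℕ → Fin 2) → LaurentField K) :
    (ℕ → Fin 2) → LaurentField K :=
  demazureLusztig (algebraMap K (LaurentField K) q) (swapX K i) (varX i) (varX (i + 1))
    (fun m => m ∘ adj i) (fun m => m i) (fun m => m (i + 1)) g

theorem heckeX_add (q : K) (i : ℕ) (g h : (ℕ → Fin 2) → LaurentField K) :
    heckeX q i (g + h) = heckeX q i g + heckeX q i h := by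
  funext m
  simp only [heckeX, demazureLusztig, Pi.add_apply, map_add]
  ring

theorem heckeX_smul (q : K) (i : ℕ) (c : K) (g : (ℕ → Fin 2) → LaurentField K) :
    heckeX q i (c • g) = c • heckeX q i g := by
  funext m
  simp only [heckeX, demazureLusztig, Pi.smul_apply, Algebra.smul_def, map_mul, swapX_algebraMap]
  ring

theorem evalX_mono_one_zero (i : ℕ) : evalX i (mono K 1 0) = varX i := by
  rw [evalX_mono, Pi.single_zero, add_zero, varX]

theorem evalX_mono_zero_one (i : ℕ) : evalX i (mono K 0 1) = varX (i + 1) := by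
  rw [evalX_mono, Pi.single_zero, zero_add, varX]

theorem evalX_quot_lt (i : ℕ) (j k : ℤ) :
    evalX i (divDiff K k (j + 1)) =
      (varX (i + 1) * evalX i (mono K k j) - varX i * evalX i (mono K j k)) /
        (varX i - varX (i + 1)) := by
  rw [eq_div_iff (sub_ne_zero.2 (varX_ne (by omega))), mul_comm]
  have := congrArg (evalX i) (quot_lt (K := K) j k)
  simpa only [map_mul, map_sub, evalX_mono_one_zero, evalX_mono_zero_one] using this

theorem evalX_quot_ge (i : ℕ) (j k : ℤ) :
    evalX i (mono K 1 0 * divDiff K k j) =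
      (varX i * evalX i (mono K k j) - varX i * evalX i (mono K j k)) /
        (varX i - varX (i + 1)) := by
  rw [eq_div_iff (sub_ne_zero.2 (varX_ne (by omega))), mul_comm]
  have := congrArg (evalX i) (quot_ge (K := K) j k)
  simpa only [map_mul, map_sub, evalX_mono_one_zero, evalX_mono_zero_one, mul_sub] using this

theorem comp_adj_eq_self {m : ℕ → Fin 2} {i : ℕ} (h : m i = m (i + 1)) : m ∘ adj i = m := by
  funext k
  simp only [Function.comp_apply, adj, Equiv.swap_apply_def]
  split_ifs with h1 h2
  · rw [h1, h]
  · rw [h2, h]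
  · rfl

theorem realize_heckeT_single (q : K) (i : ℕ) (t : PureTensor 2) :
    realize (heckeT q i (Finsupp.single t 1)) = heckeX q i (realize (Finsupp.single t 1)) := by
  classical
  funext μ
  set ν : ℕ → Fin 2 := fun k => (t k).2 with hν
  set d : ℕ → ℤ := fun k => (t k).1 with hd
  set rest : LaurentField K :=
    monomialX (Function.update (Function.update d i 0) (i + 1) 0) with hrest
  have hdecomp : ∀ a b : ℤ, evalX i (mono K a b) * rest =
      monomialX (Function.update (Function.update d i a) (i + 1) b) := by
    intro a b
    rw [evalX_mono, hrest, ← monomialX_add]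
    congr 1
    funext k
    simp only [Function.update_apply, Pi.add_apply, Pi.single_apply]
    split_ifs <;> simp_all
  have hd1 : monomialX d = evalX i (mono K (d i) (d (i + 1))) * rest := by
    rw [hdecomp]
    congr 1
    funext k
    simp only [Function.update_apply]
    split_ifs <;> simp_all
  have hd2 : monomialX (d ∘ adj i) = evalX i (mono K (d (i + 1)) (d i)) * rest := by
    rw [hdecomp]
    congr 1
    funext k
    simp only [Function.update_apply, Function.comp_apply, adj, Equiv.swap_apply_def]
    split_ifs <;> simp_all
  have hν1 : Function.update (Function.update ν i (ν i)) (i + 1) (ν (i + 1)) = ν := by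
    simp
  have hν2 : Function.update (Function.update ν i (ν (i + 1))) (i + 1) (ν i) = ν ∘ adj i := by
    funext k
    simp only [Function.update_apply, Function.comp_apply, adj, Equiv.swap_apply_def]
    split_ifs <;> simp_all
  have hμ : μ ∘ adj i = ν ↔ μ = ν ∘ adj i := by
    constructor <;> rintro h <;> funext k
    · rw [← h]; simp
    · rw [h]; simp
  have ht1 : t i = (d i, ν i) := rfl
  have ht2 : t (i + 1) = (d (i + 1), ν (i + 1)) := rfl
  -- The contributions of the terms of `localT` to the coefficient function at `μ`.
  let contrib : (Label 2 × Label 2 →₀ K) →ₗ[K] LaurentField K :=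
    LinearMap.proj μ ∘ₗ realize ∘ₗ Finsupp.lmapDomain K K (replaceTwo i t)
  have keep : ∀ P, contrib (attach (ν i) (ν (i + 1)) P) =
      if μ = ν then evalX i P * rest else 0 := by
    intro P
    refine (realize_attach i t _ _ P μ).trans ?_
    rw [hν1]
  have swap : ∀ P, contrib (attach (ν (i + 1)) (ν i) P) =
      if μ = ν ∘ adj i then evalX i P * rest else 0 := by
    intro P
    refine (realize_attach i t _ _ P μ).trans ?_
    rw [hν2]
  have hl : realize (heckeT q i (Finsupp.single t 1)) μ = contrib (localT q (t i) (t (i + 1))) := by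
    rw [heckeT_single, one_smul]
    rfl
  rw [hl, ht1, ht2, heckeX, demazureLusztig]
  simp only [realize_single, ← hν, ← hd, map_one, one_mul, hμ, apply_ite (swapX K i), map_zero,
    swapX_monomialX, localT]
  simp only [hd1, hd2]
  rcases lt_trichotomy (ν i) (ν (i + 1)) with h | h | h
  · simp only [h, if_true, map_sub, map_neg, map_smul, keep, swap, Algebra.smul_def,
      evalX_quot_lt, map_pow, map_one]
    by_cases h1 : μ = ν
    · have h2 : ν ≠ ν ∘ adj i := fun h2 => h.ne (by simpa using congrFun h2 i)
      subst h1
      simp only [h2, h.ne, h, if_false, if_true]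
      ring
    · by_cases h2 : μ = ν ∘ adj i
      · have h3 : μ i ≠ μ (i + 1) := by
          rw [h2]
          simpa using h.ne'
        simp only [h1, h3, ← h2, if_false, if_true]
        ring
      · simp only [h1, h2, if_false]
        ring
  · have h2 := comp_adj_eq_self h
    simp only [h, lt_irrefl, if_true, if_false, map_sub, map_neg, map_smul, h2] at keep swap ⊢
    simp only [keep, Algebra.smul_def, evalX_quot_ge, map_sub, map_pow, map_one]
    by_cases h1 : μ = ν
    · subst h1
      simp only [h, lt_irrefl, if_true, if_false]
      ring
    · simp only [h1, if_false]
      ring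
  · simp only [h.not_gt, h.ne', if_false, map_sub, map_neg, map_smul, keep, swap,
      Algebra.smul_def, evalX_quot_ge, map_pow, map_one]
    by_cases h1 : μ = ν
    · have h2 : ν ≠ ν ∘ adj i := fun h2 => h.ne' (by simpa using congrFun h2 i)
      subst h1
      simp only [h2, h.ne', h.not_gt, if_false, if_true]
      ring
    · by_cases h2 : μ = ν ∘ adj i
      · have h3 : μ i ≠ μ (i + 1) := by
          rw [h2]
          simpa using h.ne
        simp only [h1, h3, ← h2, if_false, if_true]
        ring
      · simp only [h1, h2, if_false]
        ring

/-- `realize` intertwines the two actions of the Hecke generators. -/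
theorem realize_heckeT (q : K) (i : ℕ) (x : PureTensor 2 →₀ K) :
    realize (heckeT q i x) = heckeX q i (realize x) := by
  induction x using Finsupp.induction_linear with
  | zero =>
    have := heckeX_smul q i 0 0
    rw [zero_smul, zero_smul] at this
    rw [map_zero, map_zero, this]
  | add x y hx hy => rw [map_add, map_add, map_add, heckeX_add, hx, hy]
  | single t c =>
    rw [← mul_one c, ← smul_eq_mul, ← Finsupp.smul_single, map_smul, map_smul, map_smul,
      heckeX_smul, realize_heckeT_single]

theorem heckeT_quad (q : K) (i : ℕ) (x : PureTensor 2 →₀ K) :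
    heckeT q i (heckeT q i x) = (q ^ 2 - 1) • heckeT q i x + q ^ 2 • x := by
  apply realize_injective
  rw [map_add, map_smul, map_smul]
  simp only [realize_heckeT]
  funext m
  simp only [Pi.add_apply, Algebra.smul_def, map_sub, map_pow, map_one]
  refine demazureLusztig_quad (swapX_algebraMap i q) ?_ ?_ (varX_ne (by omega)) (swapX_swapX i)
    (fun m => ?_) (fun m => ?_) (fun m => ?_) (fun m h => ?_) _ m
  · rw [swapX_varX, adj_apply_left]
  · rw [swapX_varX, adj_apply_right]
  · funext k; simp
  · simp
  · simp
  · exact comp_adj_eq_self h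

theorem heckeT_comm (q : K) {i j : ℕ} (hij : i + 2 ≤ j) (x : PureTensor 2 →₀ K) :
    heckeT q i (heckeT q j x) = heckeT q j (heckeT q i x) := by
  apply realize_injective
  simp only [realize_heckeT]
  refine demazureLusztig_comm (swapX_algebraMap i q) (swapX_algebraMap j q) ?_ ?_ ?_ ?_
    (swapX_comm hij) (fun m => ?_) (fun m => ?_) (fun m => ?_) (fun m => ?_) (fun m => ?_) _
  · rw [swapX_varX, adj_apply_of_ne (by omega) (by omega)]
  · rw [swapX_varX, adj_apply_of_ne (by omega) (by omega)]
  · rw [swapX_varX, adj_apply_of_ne (by omega) (by omega)]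
  · rw [swapX_varX, adj_apply_of_ne (by omega) (by omega)]
  · funext k
    exact congrArg m (Equiv.congr_fun (adj_comm hij) k)
  · simp [adj_apply_of_ne (show i ≠ j by omega) (show i ≠ j + 1 by omega)]
  · simp [adj_apply_of_ne (show i + 1 ≠ j by omega) (show i + 1 ≠ j + 1 by omega)]
  · simp [adj_apply_of_ne (show j ≠ i by omega) (show j ≠ i + 1 by omega)]
  · simp [adj_apply_of_ne (show j + 1 ≠ i by omega) (show j + 1 ≠ i + 1 by omega)]

theorem heckeT_braid (q : K) (i : ℕ) (x : PureTensor 2 →₀ K) :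
    heckeT q i (heckeT q (i + 1) (heckeT q i x)) =
      heckeT q (i + 1) (heckeT q i (heckeT q (i + 1) x)) := by
  apply realize_injective
  simp only [realize_heckeT]
  have e1 : adj i (i + 2) = i + 2 := adj_apply_of_ne (by omega) (by omega)
  have e2 : adj (i + 1) i = i := adj_apply_of_ne (by omega) (by omega)
  refine demazureLusztig_braid (swapX_algebraMap i q) (swapX_algebraMap (i + 1) q)
    ?_ ?_ ?_ ?_ ?_ ?_ (varX_ne (by omega)) (varX_ne (by omega)) (varX_ne (by omega))
    (swapX_swapX i) (swapX_swapX (i + 1)) (swapX_braid i) (fun m => ?_) (fun m => ?_)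
    (fun m => ?_) (fun m => ?_) (fun m => ?_) (fun m => ?_) (fun m => ?_) (fun m => ?_)
    (fun m => ?_) (fun m h => comp_adj_eq_self h) (fun m h => comp_adj_eq_self h) _
  · rw [swapX_varX, adj_apply_left]
  · rw [swapX_varX, adj_apply_right]
  · rw [swapX_varX, e1]
  · rw [swapX_varX, e2]
  · rw [swapX_varX, adj_apply_left]
  · rw [swapX_varX, adj_apply_right]
  · funext k; simp
  · funext k; simp
  · funext k
    exact congrArg m (Equiv.congr_fun (adj_braid i).symm k)
  · simp
  · simp
  · simp [e1]
  · simp [e2]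
  · simp
  · exact congrArg m (adj_apply_right (i + 1))

/-- The Hecke generators, acting on the right. -/
noncomputable def heckeOp (q : K) (i : ℕ) : (Module.End K (PureTensor 2 →₀ K))ᵐᵒᵖ :=
  MulOpposite.op (heckeT q i)

theorem isHecke_heckeOp (q : K) : IsHecke q (heckeOp q) where
  quad i := MulOpposite.unop_injective (LinearMap.ext (heckeT_quad q i))
  comm _ _ h := MulOpposite.unop_injective (LinearMap.ext fun x => (heckeT_comm q h x).symm)
  braid i := MulOpposite.unop_injective (LinearMap.ext (heckeT_braid q i))

theorem heckeWord_eq (q : K) (l : List ℕ) (x : PureTensor 2 →₀ K) :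
    heckeWord q l x = (l.map (heckeOp q)).prod.unop x := by
  induction l generalizing x with
  | nil => rfl
  | cons i l ih =>
    rw [List.map_cons, List.prod_cons, MulOpposite.unop_mul, Module.End.mul_apply, ← ih]
    rfl

theorem actT_eq (q : K) (σ : SInf) (x : PureTensor 2 →₀ K) :
    actT q σ x = (heckeElt (heckeOp q) σ).unop x :=
  heckeWord_eq q _ x

end LaurentField

/-! ### The order of the basis vectors of `V(z)` -/

section Height

variable {K : Type*} [Field K]

/-- The position of `z ^ j v_m` in the ordered basis
`…, z v₂, z v₁, z² v₂, z² v₁, …` of `V(z)`, in which `z v₂` has the position `0`. -/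
def height (a : Label 2) : ℤ := 2 * a.1 - 1 - (a.2 : ℕ)

theorem height_injective : Function.Injective height := by
  rintro ⟨j, m⟩ ⟨k, l⟩ h
  simp only [height] at h
  have hm := m.2
  have hl := l.2
  refine Prod.ext ?_ (Fin.ext ?_) <;> simp only <;> omega

theorem height_vacuum₀ (k : ℕ) : height (vacuum₀ k) = k := by
  obtain ⟨j, rfl | rfl⟩ := Nat.even_or_odd' k
  · have := vacuum_zero_even j
    simp only [vacuum, Fin.val_zero, add_zero] at this
    rw [this]
    simp [height, zv₂]
    ring
  · have := vacuum_zero_odd j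
    simp only [vacuum, Fin.val_zero, add_zero] at this
    rw [this]
    simp [height, zv₁]
    ring

theorem eq_vacuum₀_of_height {a : Label 2} {k : ℕ} (h : height a = k) : a = vacuum₀ k :=
  height_injective (h.trans (height_vacuum₀ k).symm)

theorem attach_mono (m l : Fin 2) (a b : ℤ) :
    attach m l (mono K a b) = Finsupp.single ((a, m), (b, l)) 1 := by
  simp [attach, mono]

theorem attach_neg (m l : Fin 2) (P : AddMonoidAlgebra K (ℤ × ℤ)) :
    attach m l (-P) = -attach m l P := by
  have h := attach_add m l P (-P)
  rw [add_neg_cancel] at h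
  have h0 : attach m l (0 : AddMonoidAlgebra K (ℤ × ℤ)) = 0 := by simp [attach]
  rw [h0] at h
  exact (neg_eq_of_add_eq_zero_right h.symm).symm

theorem attach_sum {ι : Type*} (m l : Fin 2) (s : Finset ι)
    (P : ι → AddMonoidAlgebra K (ℤ × ℤ)) :
    attach m l (∑ i ∈ s, P i) = ∑ i ∈ s, attach m l (P i) := by
  classical
  induction s using Finset.induction_on with
  | empty => simp [attach]
  | insert i s hi ih => rw [Finset.sum_insert hi, Finset.sum_insert hi, attach_add, ih]

/-- The terms of a divided difference, multiplied by a power of `z₁`. -/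
theorem attach_divDiff_mem {S : Set (Label 2 × Label 2)} (m l : Fin 2) (c a b : ℤ)
    (h : ∀ e f : ℤ, e + f = a + b - 1 → min a b ≤ e → e < max a b →
      (((c + e, m), (f, l)) : Label 2 × Label 2) ∈ S) :
    attach m l (mono K c 0 * divDiff K a b) ∈ Finsupp.supported K K S := by
  have hterm : ∀ e f : ℤ, e + f = a + b - 1 → min a b ≤ e → e < max a b →
      attach m l (mono K c 0 * mono K e f) ∈ Finsupp.supported K K S := by
    intro e f h1 h2 h3
    rw [mono_mul, attach_mono, zero_add]
    exact Finsupp.single_mem_supported K _ (h e f h1 h2 h3)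
  unfold divDiff
  split_ifs with hab
  · rw [Finset.mul_sum, attach_sum]
    refine Submodule.sum_mem _ fun s hs => hterm _ _ ?_ ?_ ?_ <;>
      rw [Finset.mem_range] at hs <;> omega
  · rw [mul_neg, attach_neg, Finset.mul_sum, attach_sum]
    refine Submodule.neg_mem _ (Submodule.sum_mem _ fun s hs => hterm _ _ ?_ ?_ ?_) <;>
      rw [Finset.mem_range] at hs <;> omega

theorem attach_divDiff_mem' {S : Set (Label 2 × Label 2)} (m l : Fin 2) (a b : ℤ)
    (h : ∀ e f : ℤ, e + f = a + b - 1 → min a b ≤ e → e < max a b →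
      (((e, m), (f, l)) : Label 2 × Label 2) ∈ S) :
    attach m l (divDiff K a b) ∈ Finsupp.supported K K S := by
  have h1 : mono K 0 0 = 1 := rfl
  rw [← one_mul (divDiff K a b), ← h1]
  refine attach_divDiff_mem m l 0 a b fun e f h1 h2 h3 => ?_
  rw [zero_add]
  exact h e f h1 h2 h3

/-- Peels the term `z₁ ^ k z₂ ^ j` off the quotient in `localT`; for `j < k` the remaining exponents
lie strictly between `j` and `k`. -/
theorem mono_mul_divDiff (j k : ℤ) :
    mono K 1 0 * divDiff K k j = mono K k j + divDiff K k (j + 1) := by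
  have hne : mono K 1 0 - mono K 0 1 ≠ 0 := by
    rw [sub_ne_zero]
    intro h
    have := AddMonoidAlgebra.single_left_injective (one_ne_zero (α := K)) h
    simp at this
  refine mul_left_cancel₀ hne ?_
  rw [quot_ge, mul_add, quot_lt, sub_mul]
  ring

/-- The coefficient of the exchanged tensor `b ⊗ a` in `(a ⊗ b) · T`, for `a` before `b`. -/
def leadCoeff (q : K) (a b : Label 2) : K := if a.2 = b.2 then -q ^ 2 else -q

theorem leadCoeff_ne_zero {q : K} (hq : q ≠ 0) (a b : Label 2) : leadCoeff q a b ≠ 0 := by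
  unfold leadCoeff
  split_ifs
  · exact neg_ne_zero.2 (pow_ne_zero 2 hq)
  · exact neg_ne_zero.2 hq

/-- For `a` before `b` in the ordered basis, `(a ⊗ b) · T` is a multiple of `b ⊗ a` up to tensors
of basis vectors strictly between `a` and `b`. -/
theorem localT_of_lt (q : K) {a b : Label 2} (h : height a < height b) :
    localT q a b - leadCoeff q a b • Finsupp.single (b, a) 1 ∈
      Finsupp.supported K K {p : Label 2 × Label 2 |
        (height a < height p.1 ∧ height p.1 < height b) ∧
        (height a < height p.2 ∧ height p.2 < height b)} := by
  obtain ⟨j, m⟩ := a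
  obtain ⟨k, l⟩ := b
  simp only [localT, leadCoeff]
  rcases lt_trichotomy m l with hml | rfl | hml
  · obtain ⟨rfl, rfl⟩ : m = 0 ∧ l = 1 := by omega
    simp only [height, Fin.val_zero, Fin.val_one] at h
    rw [if_pos hml, if_neg hml.ne, attach_mono]
    have : ∀ x y : Label 2 × Label 2 →₀ K, -(q • x) - y - (-q) • x = -y := fun x y => by module
    rw [this]
    refine Submodule.neg_mem _ (Submodule.smul_mem _ _ (attach_divDiff_mem' _ _ _ _ ?_))
    intro e f h1 h2 h3
    simp only [height, Fin.val_zero, Fin.val_one, Set.mem_ofPred_eq]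
    omega
  · rw [if_neg (lt_irrefl _), if_pos rfl, if_pos rfl, mono_mul_divDiff, attach_add, attach_mono]
    have : ∀ x y : Label 2 × Label 2 →₀ K,
        -x - (q ^ 2 - 1) • (x + y) - (-q ^ 2) • x = -((q ^ 2 - 1) • y) := fun x y => by module
    rw [this]
    refine Submodule.neg_mem _ (Submodule.smul_mem _ _ (attach_divDiff_mem' _ _ _ _ ?_))
    intro e f h1 h2 h3
    simp only [height, Set.mem_ofPred_eq] at h ⊢
    omega
  · obtain ⟨rfl, rfl⟩ : m = 1 ∧ l = 0 := by omega
    simp only [height, Fin.val_zero, Fin.val_one] at h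
    rw [if_neg hml.not_gt, if_neg hml.ne', if_neg hml.ne', attach_mono]
    have : ∀ x y : Label 2 × Label 2 →₀ K, -(q • x) - y - (-q) • x = -y := fun x y => by module
    rw [this]
    refine Submodule.neg_mem _ (Submodule.smul_mem _ _ (attach_divDiff_mem _ _ _ _ _ ?_))
    intro e f h1 h2 h3
    simp only [height, Fin.val_zero, Fin.val_one, Set.mem_ofPred_eq]
    omega

theorem localT_mem_of_lt (q : K) {a b : Label 2} (h : height a < height b) :
    localT q a b ∈ Finsupp.supported K K {p : Label 2 × Label 2 |
      height p.1 ≤ height b ∧ height p.2 < height b} := by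
  rw [← sub_add_cancel (localT q a b) (leadCoeff q a b • Finsupp.single (b, a) 1)]
  refine Submodule.add_mem _ (Finsupp.supported_mono ?_ (localT_of_lt q h))
    (Submodule.smul_mem _ _ (Finsupp.single_mem_supported K _ ⟨le_rfl, h⟩))
  rintro p ⟨⟨-, h1⟩, -, h2⟩
  exact ⟨h1.le, h2⟩

/-- The action of `T` does not increase the largest height. -/
theorem localT_mem_le (q : K) (a b : Label 2) :
    localT q a b ∈ Finsupp.supported K K {p : Label 2 × Label 2 |
      height p.1 ≤ max (height a) (height b) ∧ height p.2 ≤ max (height a) (height b)} := by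
  obtain ⟨j, m⟩ := a
  obtain ⟨k, l⟩ := b
  simp only [localT]
  rcases lt_trichotomy m l with hml | rfl | hml
  · obtain ⟨rfl, rfl⟩ : m = 0 ∧ l = 1 := by omega
    rw [if_pos hml, attach_mono]
    refine Submodule.sub_mem _ (Submodule.neg_mem _ (Submodule.smul_mem _ _
      (Finsupp.single_mem_supported K _ ⟨le_max_right _ _, le_max_left _ _⟩)))
      (Submodule.smul_mem _ _ (attach_divDiff_mem' _ _ _ _ ?_))
    intro e f h1 h2 h3
    simp only [height, Fin.val_zero, Fin.val_one, Set.mem_ofPred_eq]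
    omega
  · rw [if_neg (lt_irrefl _), if_pos rfl, attach_mono]
    refine Submodule.sub_mem _ (Submodule.neg_mem _
      (Finsupp.single_mem_supported K _ ⟨le_max_right _ _, le_max_left _ _⟩))
      (Submodule.smul_mem _ _ (attach_divDiff_mem _ _ _ _ _ ?_))
    intro e f h1 h2 h3
    simp only [height, Set.mem_ofPred_eq]
    omega
  · obtain ⟨rfl, rfl⟩ : m = 1 ∧ l = 0 := by omega
    rw [if_neg hml.not_gt, if_neg hml.ne', attach_mono]
    refine Submodule.sub_mem _ (Submodule.neg_mem _ (Submodule.smul_mem _ _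
      (Finsupp.single_mem_supported K _ ⟨le_max_right _ _, le_max_left _ _⟩)))
      (Submodule.smul_mem _ _ (attach_divDiff_mem _ _ _ _ _ ?_))
    intro e f h1 h2 h3
    simp only [height, Fin.val_zero, Fin.val_one, Set.mem_ofPred_eq]
    omega

theorem localT_self (q : K) (a : Label 2) : localT q a a = -Finsupp.single (a, a) 1 := by
  obtain ⟨j, m⟩ := a
  have h0 : divDiff K j j = 0 := by simp [divDiff]
  have h1 : attach m m (0 : AddMonoidAlgebra K (ℤ × ℤ)) = 0 := by simp [attach]
  simp only [localT, lt_irrefl, if_true, if_false, h0, mul_zero, h1, smul_zero, sub_zero,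
    attach_mono]

end Height

/-! ### Wedges as finite symmetrizations -/

section Wedges

variable {K : Type*} [Field K]

theorem mapDomain_mem_supported {α β : Type*} (f : α → β) {S : Set α} {B : Set β} {x : α →₀ K}
    (hx : x ∈ Finsupp.supported K K S) (h : ∀ a ∈ S, f a ∈ B) :
    x.mapDomain f ∈ Finsupp.supported K K B := by
  classical
  rw [Finsupp.mem_supported] at hx ⊢
  intro b hb
  obtain ⟨a, ha, rfl⟩ := Finset.mem_image.1 (Finsupp.mapDomain_support hb)
  exact h a (hx ha)

theorem map_mem_of_supported {α V : Type*} [AddCommGroup V] [Module K V] (f : (α →₀ K) →ₗ[K] V)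
    (W : Submodule K V) {S : Set α} (h : ∀ a ∈ S, f (Finsupp.single a 1) ∈ W) {x : α →₀ K}
    (hx : x ∈ Finsupp.supported K K S) : f x ∈ W := by
  rw [Finsupp.supported_eq_span_single] at hx
  have : Submodule.span K ((fun i => Finsupp.single i (1 : K)) '' S) ≤ W.comap f :=
    Submodule.span_le.2 (by rintro _ ⟨a, ha, rfl⟩; exact h a ha)
  exact this hx

/-- A Hecke generator maps combinations of tensors in `A` to combinations of tensors in `B` if it
does so locally. -/
theorem heckeT_mem_supported (q : K) (i : ℕ) {A B : Set (PureTensor 2)}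
    (h : ∀ t ∈ A, ∃ S, localT q (t i) (t (i + 1)) ∈ Finsupp.supported K K S ∧
      ∀ p ∈ S, replaceTwo i t p ∈ B)
    {x : PureTensor 2 →₀ K} (hx : x ∈ Finsupp.supported K K A) :
    heckeT q i x ∈ Finsupp.supported K K B := by
  refine map_mem_of_supported _ _ (fun t ht => ?_) hx
  obtain ⟨S, hS, hB⟩ := h t ht
  rw [heckeT_single, one_smul]
  exact mapDomain_mem_supported _ hS hB

theorem localT_mem_univ (q : K) (a b : Label 2) :
    localT q a b ∈ Finsupp.supported K K (Set.univ : Set (Label 2 × Label 2)) := by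
  rw [Finsupp.supported_univ]
  trivial

theorem replaceTwo_of_ne {i k : ℕ} (t : PureTensor 2) (p : Label 2 × Label 2) (h : k ≠ i)
    (h' : k ≠ i + 1) : replaceTwo i t p k = t k := by
  rw [replaceTwo, Function.update_of_ne h', Function.update_of_ne h]

@[simp] theorem replaceTwo_left (i : ℕ) (t : PureTensor 2) (p : Label 2 × Label 2) :
    replaceTwo i t p i = p.1 := by
  rw [replaceTwo, Function.update_of_ne (by omega), Function.update_self]

@[simp] theorem replaceTwo_right (i : ℕ) (t : PureTensor 2) (p : Label 2 × Label 2) :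
    replaceTwo i t p (i + 1) = p.2 := by
  rw [replaceTwo, Function.update_self]

theorem actT_one (q : K) (x : PureTensor 2 →₀ K) : actT q 1 x = x := by
  rw [actT_eq, (isHecke_heckeOp q).heckeElt_one]
  rfl

theorem actT_mul_adj (q : K) (σ : SInf) (i : ℕ)
    (hi : (σ : Equiv.Perm ℕ) i < (σ : Equiv.Perm ℕ) (i + 1)) (x : PureTensor 2 →₀ K) :
    actT q (σ * adjS i) x = heckeT q i (actT q σ x) := by
  rw [actT_eq, (isHecke_heckeOp q).heckeElt_mul_adj σ i hi, actT_eq]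
  rfl

theorem mul_adjS_mul_adjS (σ : SInf) (i : ℕ) : σ * adjS i * adjS i = σ :=
  Subtype.ext (mul_adj_mul_adj _ i)

/-- The factor of `t` at position `M` is later in the ordered basis than all factors before it. -/
def Dominates (t : PureTensor 2) (M : ℕ) : Prop := ∀ i < M, height (t i) < height (t M)

theorem actT_mem_of_permsBelow (q : K) {t : PureTensor 2} {M : ℕ} (ht : Dominates t M) {σ : SInf}
    (hσ : (σ : Equiv.Perm ℕ) ∈ permsBelow M) :
    actT q σ (Finsupp.single t 1) ∈ Finsupp.supported K K
      {w | (∀ k ≥ M, w k = t k) ∧ ∀ i < M, height (w i) < height (t M)} := by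
  have key : ∀ σ : Equiv.Perm ℕ, σ ∈ permsBelow M → ∀ hσ : σ ∈ SInf,
      actT q ⟨σ, hσ⟩ (Finsupp.single t 1) ∈ Finsupp.supported K K
        {w | (∀ k ≥ M, w k = t k) ∧ ∀ i < M, height (w i) < height (t M)} := by
    intro σ hσ
    refine permsBelow_induction (M := M) (P := fun σ => ∀ hσ : σ ∈ SInf,
      actT q ⟨σ, hσ⟩ (Finsupp.single t 1) ∈ Finsupp.supported K K
        {w | (∀ k ≥ M, w k = t k) ∧ ∀ i < M, height (w i) < height (t M)}) ?_ ?_ hσ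
    · intro h1
      have e1 : (⟨1, h1⟩ : SInf) = 1 := rfl
      rw [e1, actT_one]
      exact Finsupp.single_mem_supported K _ ⟨fun _ _ => rfl, ht⟩
    · rintro σ i hσ hiM hi ih hS
      have hσS := permsBelow_le_SInf M hσ
      have e1 : (⟨σ * adj i, hS⟩ : SInf) = ⟨σ, hσS⟩ * adjS i := rfl
      rw [e1, actT_mul_adj q _ _ hi]
      refine heckeT_mem_supported q i (fun w hw => ⟨_, localT_mem_le q _ _, ?_⟩) (ih hσS)
      rintro p ⟨hp1, hp2⟩
      have hmax : max (height (w i)) (height (w (i + 1))) < height (t M) :=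
        max_lt (hw.2 i (by omega)) (hw.2 (i + 1) hiM)
      refine ⟨fun k hk => ?_, fun k hk => ?_⟩
      · rw [replaceTwo_of_ne _ _ (by omega) (by omega), hw.1 k hk]
      · by_cases h1 : k = i
        · subst h1
          rw [replaceTwo_left]
          exact hp1.trans_lt hmax
        · by_cases h2 : k = i + 1
          · subst h2
            rw [replaceTwo_right]
            exact hp2.trans_lt hmax
          · rw [replaceTwo_of_ne _ _ h1 h2]
            exact hw.2 k hk
  exact key σ hσ σ.2

/-- If `σ ∈ S_{M+1}` moves `M`, then all tensors in `t · T_σ` differ from `t` at the position `M`: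
write `σ = τ s_{M-1} ⋯ s_{p+1} s_p` with `τ ∈ S_M` and `σ p = M`. The generator `T_{M-1}` moves the
largest vector away from the position `M`, which the remaining generators do not touch. -/
theorem actT_mem_of_notMem_permsBelow (q : K) {t : PureTensor 2} {M : ℕ} (ht : Dominates t M)
    {σ : SInf} (hσ : (σ : Equiv.Perm ℕ) ∈ permsBelow (M + 1))
    (hσ' : (σ : Equiv.Perm ℕ) ∉ permsBelow M) :
    actT q σ (Finsupp.single t 1) ∈ Finsupp.supported K K {w | height (w M) < height (t M)} := by
  have key : ∀ (d p : ℕ) (σ : SInf), p + d + 1 = M → (σ : Equiv.Perm ℕ) ∈ permsBelow (M + 1) →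
      (σ : Equiv.Perm ℕ) p = M →
      actT q σ (Finsupp.single t 1) ∈
        Finsupp.supported K K {w | height (w M) < height (t M)} := by
    intro d
    induction d with
    | zero =>
      intro p σ hp hσ hσp
      obtain rfl : M = p + 1 := by omega
      have hτ : ((σ * adjS p : SInf) : Equiv.Perm ℕ) ∈ permsBelow (p + 1) := by
        intro k hk
        change (σ : Equiv.Perm ℕ) (adj p k) = k
        by_cases hk' : k = p + 1
        · rw [hk', adj_apply_right, hσp]
        · rw [adj_apply_of_ne (by omega) hk', hσ k (by omega)]
      have hasc : ((σ * adjS p : SInf) : Equiv.Perm ℕ) p <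
          ((σ * adjS p : SInf) : Equiv.Perm ℕ) (p + 1) := by
        rw [hτ (p + 1) le_rfl]
        exact lt_of_mem_permsBelow hτ (by omega)
      rw [← mul_adjS_mul_adjS σ p, actT_mul_adj q _ _ hasc]
      refine heckeT_mem_supported q p (fun w hw => ?_) (actT_mem_of_permsBelow q ht hτ)
      have hlt : height (w p) < height (w (p + 1)) := by
        rw [hw.1 (p + 1) le_rfl]
        exact hw.2 p (by omega)
      refine ⟨_, localT_mem_of_lt q hlt, ?_⟩
      rintro x ⟨-, hx⟩
      simp only [Set.mem_ofPred_eq, replaceTwo_right]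
      rwa [hw.1 (p + 1) le_rfl] at hx
    | succ d ih =>
      intro p σ hp hσ hσp
      have hτ : ((σ * adjS p : SInf) : Equiv.Perm ℕ) ∈ permsBelow (M + 1) :=
        mul_mem hσ (adj_mem_permsBelow (by omega))
      have hτp : ((σ * adjS p : SInf) : Equiv.Perm ℕ) (p + 1) = M := by
        change (σ : Equiv.Perm ℕ) (adj p (p + 1)) = M
        rw [adj_apply_right, hσp]
      have hasc : ((σ * adjS p : SInf) : Equiv.Perm ℕ) p <
          ((σ * adjS p : SInf) : Equiv.Perm ℕ) (p + 1) := by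
        have h1 := lt_of_mem_permsBelow hτ (show p < M + 1 by omega)
        have h2 := apply_ne_apply_succ ((σ * adjS p : SInf) : Equiv.Perm ℕ) p
        omega
      rw [← mul_adjS_mul_adjS σ p, actT_mul_adj q _ _ hasc]
      refine heckeT_mem_supported q p (fun w hw => ⟨_, localT_mem_univ q _ _, fun x _ => ?_⟩)
        (ih (p + 1) _ (by omega) hτ hτp)
      simp only [Set.mem_ofPred_eq]
      rwa [replaceTwo_of_ne _ _ (by omega) (by omega)]
  set p := (σ : Equiv.Perm ℕ)⁻¹ M with hp
  have hσp : (σ : Equiv.Perm ℕ) p = M := by simp [hp]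
  have hpM : p < M := by
    have h1 : p < M + 1 := lt_of_mem_permsBelow (inv_mem hσ) (by omega)
    have h2 : p ≠ M := by
      intro h2
      rw [h2] at hσp
      refine hσ' fun k hk => ?_
      rcases hk.eq_or_lt with rfl | hk
      · exact hσp
      · exact hσ k hk
    omega
  exact key (M - p - 1) p σ (by omega) hσ hσp

/-- The symmetrization `∑_{σ ∈ S_M} x · T_σ`. -/
noncomputable def symmOp (q : K) (M : ℕ) : Module.End K (PureTensor 2 →₀ K) :=
  (symmetrizer (heckeOp q) M).unop

theorem symmOp_apply (q : K) (M : ℕ) (x : PureTensor 2 →₀ K) :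
    symmOp q M x = ∑ σ ∈ permsFinset M, actT q σ x := by
  simp only [actT_eq, symmOp, symmetrizer]
  rw [Finset.unop_sum, LinearMap.sum_apply]

section Dominated

variable {q : K} {t : PureTensor 2} {N : ℕ}

/-- If `w` agrees with `t` from the position `M` on, then only `σ ∈ S_M` contribute to the
coefficient of `w`. -/
theorem mem_permsBelow_of_wedgeTerm_ne_zero (ht : ∀ M ≥ N, Dominates t M) {w : PureTensor 2}
    {M : ℕ} (hM : N ≤ M) (hw : ∀ k ≥ M, w k = t k) {σ : SInf} (h : wedgeTerm q t σ w ≠ 0) :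
    (σ : Equiv.Perm ℕ) ∈ permsBelow M := by
  obtain ⟨L, hL⟩ := exists_mem_permsBelow σ.2
  by_contra hcon
  have hex : ∃ d, (σ : Equiv.Perm ℕ) ∈ permsBelow (M + d) :=
    ⟨L, permsBelow_mono (by omega) hL⟩
  classical
  obtain ⟨d, hd, hmin⟩ : ∃ d, (σ : Equiv.Perm ℕ) ∈ permsBelow (M + d + 1) ∧
      (σ : Equiv.Perm ℕ) ∉ permsBelow (M + d) := by
    have h0 : Nat.find hex ≠ 0 := fun h0 => hcon (by simpa [h0] using Nat.find_spec hex)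
    obtain ⟨d, hd⟩ := Nat.exists_eq_succ_of_ne_zero h0
    refine ⟨d, ?_, Nat.find_min hex (by omega)⟩
    have := Nat.find_spec hex
    rw [hd] at this
    exact this
  have hmem := (Finsupp.mem_supported _ _).1
    (actT_mem_of_notMem_permsBelow q (ht (M + d) (by omega)) hd hmin)
    (Finsupp.mem_support_iff.2 h)
  simp only [Set.mem_ofPred_eq] at hmem
  rw [hw (M + d) (by omega)] at hmem
  exact lt_irrefl _ hmem

theorem exists_eq_of_wedgeTerm_ne_zero (ht : ∀ M ≥ N, Dominates t M) {w : PureTensor 2}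
    {σ : SInf} (h : wedgeTerm q t σ w ≠ 0) : ∃ M ≥ N, ∀ k ≥ M, w k = t k := by
  obtain ⟨L, hL⟩ := exists_mem_permsBelow σ.2
  refine ⟨max N L, le_max_left _ _, ?_⟩
  exact ((Finsupp.mem_supported _ _).1 (actT_mem_of_permsBelow q (ht _ (le_max_left N L))
    (permsBelow_mono (le_max_right N L) hL)) (Finsupp.mem_support_iff.2 h)).1

theorem formalSummable_wedgeTerm (ht : ∀ M ≥ N, Dominates t M) :
    FormalSummable (wedgeTerm q t) := by
  intro w
  by_cases h : ∃ M ≥ N, ∀ k ≥ M, w k = t k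
  · obtain ⟨M, hM, hw⟩ := h
    exact (finite_permsBelow M).subset fun σ hσ =>
      mem_permsBelow_of_wedgeTerm_ne_zero ht hM hw hσ
  · convert Set.finite_empty
    ext σ
    simp only [Set.mem_ofPred_eq, Set.mem_empty_iff_false, iff_false]
    exact fun hσ => h (exists_eq_of_wedgeTerm_ne_zero ht hσ)

/-- Each coefficient of a wedge is a coefficient of a finite symmetrization. -/
theorem wedge_apply (ht : ∀ M ≥ N, Dominates t M) {w : PureTensor 2} {M : ℕ} (hM : N ≤ M)
    (hw : ∀ k ≥ M, w k = t k) : wedge q t w = symmOp q M (Finsupp.single t 1) w := by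
  rw [symmOp_apply, Finsupp.finsetSum_apply]
  refine finsum_eq_sum_of_support_subset _ fun σ hσ => ?_
  exact mem_permsFinset.2 (mem_permsBelow_of_wedgeTerm_ne_zero ht hM hw hσ)

theorem wedge_apply_eq_zero (ht : ∀ M ≥ N, Dominates t M) {w : PureTensor 2}
    (hw : ¬∃ M, ∀ k ≥ M, w k = t k) : wedge q t w = 0 := by
  refine finsum_eq_zero_of_forall_eq_zero fun σ => ?_
  by_contra h
  obtain ⟨M, -, hM⟩ := exists_eq_of_wedgeTerm_ne_zero ht h
  exact hw ⟨M, hM⟩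

end Dominated

/-! ### Vanishing of wedges with a repeated factor -/

theorem symmOp_heckeT (q : K) {i M : ℕ} (hi : i + 1 < M) (x : PureTensor 2 →₀ K) :
    symmOp q M (heckeT q i x) = q ^ 2 • symmOp q M x := by
  have h := congrArg MulOpposite.unop ((isHecke_heckeOp q).mul_symmetrizer hi)
  exact LinearMap.congr_fun h x

/-- The wedge vanishes on tensors with two equal neighbours. -/
theorem symmOp_single_eq_zero_of_eq (q : K) {i M : ℕ} (hi : i + 1 < M) {t : PureTensor 2}
    (ht : t i = t (i + 1)) : symmOp q M (Finsupp.single t 1) = 0 := by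
  obtain ⟨X, hX⟩ := (isHecke_heckeOp q).exists_symmetrizer_eq hi
  have h1 : heckeT q i (Finsupp.single t 1) = -Finsupp.single t 1 := by
    have h2 : replaceTwo i t (t i, t i) = t := by
      rw [replaceTwo, Function.update_eq_self]
      rw [ht, Function.update_eq_self]
    rw [heckeT_single, one_smul, ← ht, localT_self, ← Finsupp.lmapDomain_apply K K, map_neg,
      Finsupp.lmapDomain_apply, Finsupp.mapDomain_single, h2]
  have h3 : symmOp q M (Finsupp.single t 1) =
      X.unop (Finsupp.single t 1 + heckeT q i (Finsupp.single t 1)) := by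
    rw [symmOp, hX]
    rfl
  rw [h3, h1, add_neg_cancel, map_zero]

/-- If the factors at the positions `i` and `i + 1` are in increasing order, then the Hecke
generator exchanges them up to a scalar and up to tensors whose factor at `i + 1` lies strictly in
between. -/
theorem heckeT_single_of_lt (q : K) {i : ℕ} {t : PureTensor 2}
    (h : height (t i) < height (t (i + 1))) :
    heckeT q i (Finsupp.single t 1) - leadCoeff q (t i) (t (i + 1)) •
        Finsupp.single (replaceTwo i t (t (i + 1), t i)) 1 ∈
      Finsupp.supported K K {w | ∃ x y, w = replaceTwo i t (x, y) ∧
        height (t i) < height y ∧ height y < height (t (i + 1))} := by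
  have := mapDomain_mem_supported (replaceTwo i t)
    (B := {w | ∃ x y, w = replaceTwo i t (x, y) ∧
        height (t i) < height y ∧ height y < height (t (i + 1))}) (localT_of_lt q h)
    (fun p hp => ⟨p.1, p.2, rfl, hp.2.1, hp.2.2⟩)
  rw [← Finsupp.lmapDomain_apply K K, map_sub, map_smul, Finsupp.lmapDomain_apply,
    Finsupp.lmapDomain_apply, Finsupp.mapDomain_single] at this
  rwa [heckeT_single, one_smul]

theorem exists_vacuum₀_eq {a : Label 2} {i k : ℕ} (h1 : height (vacuum₀ i) < height a)
    (h2 : height a < height (vacuum₀ k)) : ∃ l, a = vacuum₀ l ∧ i < l ∧ l < k := by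
  rw [height_vacuum₀] at h1 h2
  exact ⟨(height a).toNat, eq_vacuum₀_of_height (by omega), by omega, by omega⟩

/-- With `u_k` the factors of the vacuum, the wedge vanishes on tensors that contain
`u_k ⊗ u_{p+1} ⊗ u_{p+2} ⊗ ⋯ ⊗ u_k`. Exchanging the first two factors leads to a shorter tensor of
the same kind; the correction terms end in `u_l ⊗ u_{p+2} ⊗ ⋯ ⊗ u_k` with `p + 1 < l < k`. -/
theorem symmOp_single_eq_zero {q : K} (hq : q ≠ 0) {M : ℕ} (t : PureTensor 2) {p k : ℕ}
    (hpk : p < k) (hk : k < M) (hp : t p = vacuum₀ k)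
    (ht : ∀ j, p < j → j ≤ k → t j = vacuum₀ j) : symmOp q M (Finsupp.single t 1) = 0 := by
  induction hd : k - p using Nat.strong_induction_on generalizing t p k with
  | _ d ih =>
  rcases Nat.eq_or_lt_of_le (Nat.succ_le_of_lt hpk) with hpk' | hpk'
  · exact symmOp_single_eq_zero_of_eq q (i := p) (by omega) (by
      rw [hp, ht (p + 1) (by omega) (by omega)]
      congr 1
      omega)
  · have hp1 : t (p + 1) = vacuum₀ (p + 1) := ht (p + 1) (by omega) (by omega)
    set t' := replaceTwo p t (t (p + 1), t p) with ht'
    have hback : replaceTwo p t' (t' (p + 1), t' p) = t := by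
      funext j
      by_cases h1 : j = p
      · subst h1
        simp [ht']
      · by_cases h2 : j = p + 1
        · subst h2
          simp [ht']
        · rw [replaceTwo_of_ne _ _ h1 h2, ht', replaceTwo_of_ne _ _ h1 h2]
    have hp' : t' p = vacuum₀ (p + 1) := by rw [ht', replaceTwo_left, hp1]
    have hp1' : t' (p + 1) = vacuum₀ k := by rw [ht', replaceTwo_right, hp]
    have htail : ∀ x j, p + 1 < j → j ≤ k → replaceTwo p t' x j = vacuum₀ j := by
      intro x j h1 h2
      rw [replaceTwo_of_ne _ _ (by omega) (by omega), ht',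
        replaceTwo_of_ne _ _ (by omega) (by omega), ht j (by omega) h2]
    have hlt : height (t' p) < height (t' (p + 1)) := by
      rw [hp', hp1', height_vacuum₀, height_vacuum₀]
      omega
    have h0 : symmOp q M (Finsupp.single t' 1) = 0 := by
      refine ih (k - (p + 1)) (by omega) t' (p := p + 1) (k := k) (by omega) hk hp1' ?_ rfl
      intro j h1 h2
      rw [ht', replaceTwo_of_ne _ _ (by omega) (by omega), ht j (by omega) h2]
    have hrest := map_mem_of_supported (symmOp q M) ⊥ ?_ (heckeT_single_of_lt q hlt)
    · rw [Submodule.mem_bot, map_sub, symmOp_heckeT q (by omega), h0, smul_zero, map_smul, hback,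
        zero_sub, neg_eq_zero] at hrest
      exact (smul_eq_zero.1 hrest).resolve_left (leadCoeff_ne_zero hq _ _)
    · rintro _ ⟨x, y, rfl, hy1, hy2⟩
      rw [hp'] at hy1
      rw [hp1'] at hy2
      obtain ⟨l, rfl, hl1, hl2⟩ := exists_vacuum₀_eq hy1 hy2
      rw [Submodule.mem_bot]
      exact ih (l - (p + 1)) (by omega) _ (p := p + 1) (k := l) hl1 (by omega)
        (replaceTwo_right _ _ _) (fun j h1 h2 => htail _ j h1 (by omega)) rfl

end Wedges

/-! ### Splitting off the first factor -/

section Split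

variable {K : Type*} [Field K]

theorem consTensor_injective (b : Label 2) : Function.Injective (consTensor b) :=
  fun _ _ h => funext fun k => congrFun h (k + 1)

theorem consTensor_eta (w : PureTensor 2) : consTensor (w 0) (fun k => w (k + 1)) = w := by
  funext k
  cases k <;> rfl

theorem replaceTwo_consTensor (i : ℕ) (b : Label 2) (t : PureTensor 2) (p : Label 2 × Label 2) :
    replaceTwo (i + 1) (consTensor b t) p = consTensor b (replaceTwo i t p) := by
  funext k
  rcases k with - | k
  · rw [replaceTwo_of_ne _ _ (by omega) (by omega)]
    rfl
  · by_cases h1 : k = i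
    · subst h1
      rw [replaceTwo_left]
      exact (replaceTwo_left _ _ _).symm
    · by_cases h2 : k = i + 1
      · subst h2
        rw [replaceTwo_right]
        exact (replaceTwo_right _ _ _).symm
      · rw [replaceTwo_of_ne _ _ (by omega) (by omega)]
        exact (replaceTwo_of_ne t p h1 h2).symm

theorem heckeT_mapDomain_consTensor (q : K) (i : ℕ) (b : Label 2) (x : PureTensor 2 →₀ K) :
    heckeT q (i + 1) (x.mapDomain (consTensor b)) = (heckeT q i x).mapDomain (consTensor b) := by
  induction x using Finsupp.induction_linear with
  | zero => simp
  | add x y hx hy => rw [Finsupp.mapDomain_add, map_add, map_add, Finsupp.mapDomain_add, hx, hy]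
  | single t c =>
    rw [Finsupp.mapDomain_single, heckeT_single, heckeT_single, Finsupp.mapDomain_smul,
      ← Finsupp.mapDomain_comp]
    congr 2
    funext p
    exact replaceTwo_consTensor i b t p

/-- The symmetrization over the positions `1, …, M`. -/
noncomputable def symmTail (q : K) (M : ℕ) : Module.End K (PureTensor 2 →₀ K) :=
  (symmetrizer (fun i => heckeOp q (i + 1)) M).unop

theorem symmTail_mapDomain_consTensor (q : K) (M : ℕ) (b : Label 2) (x : PureTensor 2 →₀ K) :
    symmTail q M (x.mapDomain (consTensor b)) = (symmOp q M x).mapDomain (consTensor b) := by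
  have key : ∀ (l : List ℕ) (x : PureTensor 2 →₀ K),
      (l.map fun i => heckeOp q (i + 1)).prod.unop (x.mapDomain (consTensor b)) =
        ((l.map (heckeOp q)).prod.unop x).mapDomain (consTensor b) := by
    intro l
    induction l with
    | nil => intro x; rfl
    | cons i l ih =>
      intro x
      rw [List.map_cons, List.prod_cons, MulOpposite.unop_mul, Module.End.mul_apply,
        List.map_cons, List.prod_cons, MulOpposite.unop_mul, Module.End.mul_apply, ← ih]
      exact congrArg _ (heckeT_mapDomain_consTensor q i b x)
  rw [symmTail, symmetrizer, symmOp, symmetrizer, Finset.unop_sum, Finset.unop_sum,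
    LinearMap.sum_apply, LinearMap.sum_apply]
  exact (Finset.sum_congr rfl fun σ _ => key _ x).trans
    (map_sum (Finsupp.lmapDomain K K (consTensor b)) _ _).symm

/-- The action of `T_{r-1} ⋯ T_1 T_0`. -/
noncomputable def dragOp (q : K) (r : ℕ) : Module.End K (PureTensor 2 →₀ K) :=
  (drag (heckeOp q) r).unop

theorem dragOp_succ (q : K) (r : ℕ) (x : PureTensor 2 →₀ K) :
    dragOp q (r + 1) x = dragOp q r (heckeT q r x) := rfl

theorem symmOp_succ (q : K) (M : ℕ) (x : PureTensor 2 →₀ K) :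
    symmOp q (M + 1) x = ∑ r ∈ Finset.range (M + 1), symmTail q M (dragOp q r x) := by
  rw [symmOp, (isHecke_heckeOp q).symmetrizer_succ, MulOpposite.unop_mul, Module.End.mul_apply,
    Finset.unop_sum, LinearMap.sum_apply, map_sum]
  rfl

/-! ### The vacuum -/

/-- The vacuum with the factor at position `r` moved to the position `i ≤ r`. -/
def vacInsert (r i : ℕ) : PureTensor 2 := fun k =>
  if k < i then vacuum₀ k else if k = i then vacuum₀ r else if k ≤ r then vacuum₀ (k - 1)
  else vacuum₀ k

theorem vacInsert_self (r : ℕ) : vacInsert r r = vacuum₀ := by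
  funext k
  simp only [vacInsert]
  split_ifs with h1 h2 h3
  · rfl
  · rw [h2]
  · omega
  · rfl

theorem vacInsert_zero (r : ℕ) :
    vacInsert r 0 = consTensor (vacuum₀ r) (omitFactor r vacuum₀) := by
  funext k
  rcases k with - | k
  · simp [vacInsert, consTensor]
  · simp only [vacInsert, consTensor, omitFactor]
    split_ifs <;> first | contradiction | omega | rfl

theorem replaceTwo_vacInsert {r i : ℕ} (hi : i < r) :
    replaceTwo i (vacInsert r (i + 1))
      (vacInsert r (i + 1) (i + 1), vacInsert r (i + 1) i) = vacInsert r i := by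
  funext k
  by_cases h1 : k = i
  · subst h1
    rw [replaceTwo_left]
    simp [vacInsert]
  · by_cases h2 : k = i + 1
    · subst h2
      rw [replaceTwo_right]
      simp only [vacInsert]
      split_ifs <;> first | omega | rfl
    · rw [replaceTwo_of_ne _ _ h1 h2]
      simp only [vacInsert]
      split_ifs <;> first | omega | rfl

theorem vacInsert_succ_left (r i : ℕ) : vacInsert r (i + 1) i = vacuum₀ i := by
  simp [vacInsert]

theorem vacInsert_succ_right (r i : ℕ) : vacInsert r (i + 1) (i + 1) = vacuum₀ r := by
  simp [vacInsert]

/-- The pure tensors that contain `u_l ⊗ u_{i+1} ⊗ ⋯ ⊗ u_l` for some `i < l < r`, with `u_l` at the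
position `i + 1`. Splitting off the first factor leaves tensors with a vanishing wedge. -/
def repeated (r i : ℕ) : Set (PureTensor 2) :=
  {w | ∃ l, i < l ∧ l < r ∧ w (i + 1) = vacuum₀ l ∧ ∀ j, i < j → j ≤ l → w (j + 1) = vacuum₀ j}

theorem dragOp_mem_repeated (q : K) (r i n : ℕ) (hn : n ≤ i) {x : PureTensor 2 →₀ K}
    (hx : x ∈ Finsupp.supported K K (repeated r i)) :
    dragOp q n x ∈ Finsupp.supported K K (repeated r i) := by
  induction n generalizing x with
  | zero => exact hx
  | succ n ih =>
    rw [dragOp_succ]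
    refine ih (by omega) (heckeT_mem_supported q n
      (fun w hw => ⟨_, localT_mem_univ q _ _, fun p _ => ?_⟩) hx)
    obtain ⟨l, h1, h2, h3, h4⟩ := hw
    refine ⟨l, h1, h2, ?_, fun j h5 h6 => ?_⟩
    · rw [replaceTwo_of_ne _ _ (by omega) (by omega), h3]
    · rw [replaceTwo_of_ne _ _ (by omega) (by omega), h4 j h5 h6]

/-- Moving the factor `u_r` of the vacuum to the front produces `u_r ⊗ u_0 ⊗ ⋯ ⊗ u_{r-1} ⊗ ⋯` with a
coefficient that collects the scalars of the exchanges, up to tensors with a repeated factor. -/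
theorem dragOp_vacInsert (q : K) (r i : ℕ) (hi : i ≤ r) :
    dragOp q i (Finsupp.single (vacInsert r i) 1) -
        (∏ k ∈ Finset.range i, leadCoeff q (vacuum₀ k) (vacuum₀ r)) •
          Finsupp.single (vacInsert r 0) 1 ∈
      Finsupp.supported K K (⋃ j, repeated r j) := by
  induction i with
  | zero =>
    rw [Finset.prod_range_zero, one_smul]
    have : dragOp q 0 (Finsupp.single (vacInsert r 0) 1) = Finsupp.single (vacInsert r 0) 1 := rfl
    rw [this, sub_self]
    exact Submodule.zero_mem _
  | succ i ih =>
    have hl := vacInsert_succ_left r i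
    have hr := vacInsert_succ_right r i
    have h1 := heckeT_single_of_lt q (t := vacInsert r (i + 1)) (i := i) (by
      rw [hl, hr, height_vacuum₀, height_vacuum₀]
      omega)
    rw [replaceTwo_vacInsert (by omega), hl, hr] at h1
    have h2 : heckeT q i (Finsupp.single (vacInsert r (i + 1)) 1) -
        leadCoeff q (vacuum₀ i) (vacuum₀ r) • Finsupp.single (vacInsert r i) 1 ∈
        Finsupp.supported K K (repeated r i) := by
      refine Finsupp.supported_mono ?_ h1
      rintro _ ⟨x, y, rfl, hy1, hy2⟩
      obtain ⟨l, rfl, hl1, hl2⟩ := exists_vacuum₀_eq hy1 hy2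
      refine ⟨l, hl1, hl2, replaceTwo_right _ _ _, fun j h3 h4 => ?_⟩
      rw [replaceTwo_of_ne _ _ (by omega) (by omega)]
      simp only [vacInsert]
      split_ifs <;> first | omega | rfl
    have h3 := Finsupp.supported_mono (Set.subset_iUnion (repeated r) i)
      (dragOp_mem_repeated q r i i le_rfl h2)
    rw [map_sub, map_smul] at h3
    have h4 := Submodule.add_mem _ h3 (Submodule.smul_mem _ (leadCoeff q (vacuum₀ i) (vacuum₀ r))
      (ih (by omega)))
    rw [dragOp_succ, Finset.prod_range_succ, mul_comm, mul_smul]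
    rwa [smul_sub, sub_add_sub_cancel] at h4

theorem symmTail_repeated {q : K} (hq : q ≠ 0) {M r : ℕ} (hr : r ≤ M) {x : PureTensor 2 →₀ K}
    (hx : x ∈ Finsupp.supported K K (⋃ j, repeated r j)) : symmTail q M x = 0 := by
  rw [← Submodule.mem_bot K]
  refine map_mem_of_supported _ _ (fun w hw => ?_) hx
  obtain ⟨i, l, h1, h2, h3, h4⟩ := Set.mem_iUnion.1 hw
  rw [← consTensor_eta w, ← Finsupp.mapDomain_single, symmTail_mapDomain_consTensor,
    symmOp_single_eq_zero hq (fun k => w (k + 1)) h1 (by omega) h3 h4, Finsupp.mapDomain_zero]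
  exact Submodule.zero_mem _

theorem symmTail_dragOp_vacuum {q : K} (hq : q ≠ 0) {M r : ℕ} (hr : r ≤ M) :
    symmTail q M (dragOp q r (Finsupp.single vacuum₀ 1)) =
      (∏ k ∈ Finset.range r, leadCoeff q (vacuum₀ k) (vacuum₀ r)) •
        (symmOp q M (Finsupp.single (omitFactor r vacuum₀) 1)).mapDomain
          (consTensor (vacuum₀ r)) := by
  have h := symmTail_repeated hq hr (dragOp_vacInsert q r r le_rfl)
  rw [map_sub, map_smul, sub_eq_zero, vacInsert_self, vacInsert_zero,
    ← Finsupp.mapDomain_single, symmTail_mapDomain_consTensor] at h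
  exact h

theorem vacuum₀_injective : Function.Injective vacuum₀ := by
  intro i k h
  have := congrArg height h
  rw [height_vacuum₀, height_vacuum₀] at this
  exact_mod_cast this

theorem dominates_vacuum₀ (M : ℕ) : Dominates vacuum₀ M := by
  intro i hi
  rw [height_vacuum₀, height_vacuum₀]
  omega

theorem dominates_omitFactor (r M : ℕ) : Dominates (omitFactor r vacuum₀) M := by
  intro i hi
  simp only [omitFactor]
  split_ifs <;> rw [height_vacuum₀, height_vacuum₀] <;> omega

theorem mapDomain_consTensor_apply_of_ne {b b' : Label 2} (h : b ≠ b') (x : PureTensor 2 →₀ K)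
    (w : PureTensor 2) : x.mapDomain (consTensor b) (consTensor b' w) = 0 := by
  refine Finsupp.mapDomain_of_notMem_range _ _ ?_
  rintro ⟨t, ht⟩
  exact h (congrFun ht 0)

/-- Only the tensors in which `u_r` has moved to the front, without a repeated factor behind it,
survive the symmetrization over the remaining positions. -/
theorem wedge_vacuum_consTensor_of_eventually {q : K} (hq : q ≠ 0) (b : Label 2)
    {w : PureTensor 2} {M : ℕ} (hw : ∀ k ≥ M, w k = vacuum₀ (k + 1)) :
    wedge q vacuum₀ (consTensor b w) = ∑ r ∈ Finset.range (M + 1),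
      (∏ k ∈ Finset.range r, leadCoeff q (vacuum₀ k) (vacuum₀ r)) *
        (symmOp q M (Finsupp.single (omitFactor r vacuum₀) 1)).mapDomain
          (consTensor (vacuum₀ r)) (consTensor b w) := by
  rw [wedge_apply (N := 0) (M := M + 1) (fun M _ => dominates_vacuum₀ M) (by omega),
    symmOp_succ, Finsupp.finsetSum_apply]
  · refine Finset.sum_congr rfl fun r hr => ?_
    rw [Finset.mem_range] at hr
    rw [symmTail_dragOp_vacuum hq (by omega)]
    rfl
  · rintro (- | k) hk
    · omega
    · exact hw k (by omega)

/-- The component `u_r ⊗ ⋯` of the vacuum is a multiple of the wedge in which `u_r` is left out. -/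
theorem wedge_vacuum_consTensor {q : K} (hq : q ≠ 0) (r : ℕ) (w : PureTensor 2) :
    wedge q vacuum₀ (consTensor (vacuum₀ r) w) =
      (∏ k ∈ Finset.range r, leadCoeff q (vacuum₀ k) (vacuum₀ r)) *
        wedge q (omitFactor r vacuum₀) w := by
  by_cases h : ∃ M, ∀ k ≥ M, w k = vacuum₀ (k + 1)
  · obtain ⟨M', hM'⟩ := h
    obtain ⟨M, hrM, hw⟩ : ∃ M ≥ r, ∀ k ≥ M, w k = vacuum₀ (k + 1) :=
      ⟨max r M', le_max_left _ _, fun k hk => hM' k (le_of_max_le_right hk)⟩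
    rw [wedge_vacuum_consTensor_of_eventually hq _ hw, Finset.sum_eq_single r,
      Finsupp.mapDomain_apply (consTensor_injective _),
      wedge_apply (N := 0) (M := M) (fun M _ => dominates_omitFactor r M) (by omega)]
    · intro k hk
      rw [hw k hk, omitFactor, if_neg (by omega)]
    · intro s _ hs
      rw [mapDomain_consTensor_apply_of_ne (fun h => hs (vacuum₀_injective h)), mul_zero]
    · intro h
      exact absurd (Finset.mem_range.2 (by omega)) h
  · rw [wedge_apply_eq_zero (N := 0) (fun M _ => dominates_vacuum₀ M),
      wedge_apply_eq_zero (N := 0) (fun M _ => dominates_omitFactor r M), mul_zero]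
    · rintro ⟨M, hM⟩
      refine h ⟨max r M, fun k hk => ?_⟩
      have h1 : r ≤ k := le_of_max_le_left hk
      rw [hM k (le_of_max_le_right hk), omitFactor, if_neg (by omega)]
    · rintro ⟨M, hM⟩
      exact h ⟨M, fun k hk => hM (k + 1) (by omega)⟩

theorem wedge_vacuum_consTensor_eq_zero {q : K} (hq : q ≠ 0) {b : Label 2}
    (hb : ∀ r, vacuum₀ r ≠ b) (w : PureTensor 2) : wedge q vacuum₀ (consTensor b w) = 0 := by
  by_cases h : ∃ M, ∀ k ≥ M, w k = vacuum₀ (k + 1)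
  · obtain ⟨M, hw⟩ := h
    rw [wedge_vacuum_consTensor_of_eventually hq _ hw]
    refine Finset.sum_eq_zero fun r _ => ?_
    rw [mapDomain_consTensor_apply_of_ne (hb r), mul_zero]
  · rw [wedge_apply_eq_zero (N := 0) (fun M _ => dominates_vacuum₀ M)]
    rintro ⟨M, hM⟩
    exact h ⟨M, fun k hk => hM (k + 1) (by omega)⟩

/-! ### The coefficients -/

theorem vacuum_zero : vacuum 0 = vacuum₀ := rfl

theorem vacuum₀_even (s : ℕ) : vacuum₀ (2 * s) = zv₂ (s + 1) := vacuum_zero_even s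

theorem vacuum₀_odd (s : ℕ) : vacuum₀ (2 * s + 1) = zv₁ (s + 1) := vacuum_zero_odd s

theorem leadCoeff_even_even (q : K) (s r : ℕ) :
    leadCoeff q (vacuum₀ (2 * s)) (vacuum₀ (2 * r)) = -q ^ 2 := by
  simp [vacuum₀_even, leadCoeff, zv₂]

theorem leadCoeff_odd_even (q : K) (s r : ℕ) :
    leadCoeff q (vacuum₀ (2 * s + 1)) (vacuum₀ (2 * r)) = -q := by
  rw [vacuum₀_odd, vacuum₀_even, leadCoeff, if_neg]
  simp [zv₁, zv₂]

theorem leadCoeff_even_odd (q : K) (s r : ℕ) :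
    leadCoeff q (vacuum₀ (2 * s)) (vacuum₀ (2 * r + 1)) = -q := by
  rw [vacuum₀_odd, vacuum₀_even, leadCoeff, if_neg]
  simp [zv₁, zv₂]

theorem leadCoeff_odd_odd (q : K) (s r : ℕ) :
    leadCoeff q (vacuum₀ (2 * s + 1)) (vacuum₀ (2 * r + 1)) = -q ^ 2 := by
  simp [vacuum₀_odd, leadCoeff, zv₁]

theorem prod_leadCoeff_even (q : K) (r s : ℕ) :
    ∏ k ∈ Finset.range (2 * s), leadCoeff q (vacuum₀ k) (vacuum₀ (2 * r)) = q ^ (3 * s) := by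
  induction s with
  | zero => simp
  | succ s ih =>
    rw [show 2 * (s + 1) = 2 * s + 1 + 1 by ring, Finset.prod_range_succ, Finset.prod_range_succ,
      ih, leadCoeff_even_even, leadCoeff_odd_even]
    ring

theorem prod_leadCoeff_odd (q : K) (r s : ℕ) :
    ∏ k ∈ Finset.range (2 * s), leadCoeff q (vacuum₀ k) (vacuum₀ (2 * r + 1)) = q ^ (3 * s) := by
  induction s with
  | zero => simp
  | succ s ih =>
    rw [show 2 * (s + 1) = 2 * s + 1 + 1 by ring, Finset.prod_range_succ, Finset.prod_range_succ,
      ih, leadCoeff_even_odd, leadCoeff_odd_odd]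
    ring

theorem phiTilde_apply (q : K) (b : Label 2) (w : PureTensor 2) :
    PhiTilde q 0 (highestWeight q 0) (b, w) = wedge q vacuum₀ (consTensor b w) := rfl

theorem phiTilde_zv₂ {q : K} (hq : q ≠ 0) (s : ℕ) (w : PureTensor 2) :
    PhiTilde q 0 (highestWeight q 0) (zv₂ (s + 1), w) =
      q ^ (3 * s) * wedge q (omitFactor (2 * s) (vacuum 0)) w := by
  rw [phiTilde_apply, ← vacuum₀_even, wedge_vacuum_consTensor hq, prod_leadCoeff_even]
  rfl

theorem phiTilde_zv₁ {q : K} (hq : q ≠ 0) (s : ℕ) (w : PureTensor 2) :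
    PhiTilde q 0 (highestWeight q 0) (zv₁ (s + 1), w) =
      -(q ^ (3 * s + 1) * wedge q (omitFactor (2 * s + 1) (vacuum 0)) w) := by
  rw [phiTilde_apply, ← vacuum₀_odd, wedge_vacuum_consTensor hq, Finset.prod_range_succ,
    prod_leadCoeff_odd, leadCoeff_even_odd, vacuum_zero]
  ring

theorem phiTilde_eq_zero {q : K} (hq : q ≠ 0) {b : Label 2} (h2 : ∀ s : ℕ, zv₂ (s + 1) ≠ b)
    (h1 : ∀ s : ℕ, zv₁ (s + 1) ≠ b) (w : PureTensor 2) :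
    PhiTilde q 0 (highestWeight q 0) (b, w) = 0 := by
  refine wedge_vacuum_consTensor_eq_zero hq (fun r => ?_) w
  obtain ⟨s, rfl | rfl⟩ := Nat.even_or_odd' r
  · rw [vacuum₀_even]
    exact h2 s
  · rw [vacuum₀_odd]
    exact h1 s

/-! ### The two infinite sums -/

theorem smul_tmul_apply (c : K) (a : Label 2) (y : FormalTensor K 2) (b : Label 2)
    (w : PureTensor 2) [Decidable (a = b)] :
    (c • tmul (Finsupp.single a 1) y) (b, w) = if a = b then c * y w else 0 := by
  rw [Pi.smul_apply, tmul, Finsupp.single_apply]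
  split_ifs <;> simp

theorem formalSummable_smul_tmul (c : ℕ → K) {a : ℕ → Label 2} (ha : Function.Injective a)
    (y : ℕ → FormalTensor K 2) :
    FormalSummable fun s => c s • tmul (Finsupp.single (a s) 1) (y s) := by
  classical
  rintro ⟨b, w⟩
  refine Set.Subsingleton.finite fun s hs s' hs' => ?_
  simp only [Set.mem_ofPred_eq, smul_tmul_apply] at hs hs'
  have h1 : a s = b := by
    by_contra h
    exact hs (if_neg h)
  have h2 : a s' = b := by
    by_contra h
    exact hs' (if_neg h)
  exact ha (h1.trans h2.symm)

theorem formalSum_smul_tmul_apply (c : ℕ → K) {a : ℕ → Label 2} (ha : Function.Injective a)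
    (y : ℕ → FormalTensor K 2) (s : ℕ) (w : PureTensor 2) :
    formalSum (fun s => c s • tmul (Finsupp.single (a s) 1) (y s)) (a s, w) = c s * y s w := by
  classical
  rw [formalSum, finsum_eq_single _ s]
  · rw [smul_tmul_apply, if_pos rfl]
  · intro s' hs'
    rw [smul_tmul_apply, if_neg fun h => hs' (ha h)]

theorem formalSum_smul_tmul_apply_eq_zero (c : ℕ → K) {a : ℕ → Label 2}
    (y : ℕ → FormalTensor K 2) {b : Label 2} (hb : ∀ s, a s ≠ b) (w : PureTensor 2) :
    formalSum (fun s => c s • tmul (Finsupp.single (a s) 1) (y s)) (b, w) = 0 := by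
  classical
  refine finsum_eq_zero_of_forall_eq_zero fun s => ?_
  simp only
  rw [smul_tmul_apply, if_neg (hb s)]

theorem zv₂_injective : Function.Injective fun s : ℕ => zv₂ (s + 1) := by
  intro s s' h
  simpa [zv₂] using h

theorem zv₁_injective : Function.Injective fun s : ℕ => zv₁ (s + 1) := by
  intro s s' h
  simpa [zv₁] using h

theorem zv₁_ne_zv₂ (j k : ℤ) : zv₁ j ≠ zv₂ k := by
  simp [zv₁, zv₂]

theorem wedge_omitFactor_mem_Fock (q : K) (r : ℕ) :
    wedge q (omitFactor r (vacuum 0)) ∈ Fock q 1 :=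
  Submodule.subset_span ⟨_, ⟨r, fun k hk => by
    rw [omitFactor, if_neg (by omega)]
    rfl⟩, rfl⟩

end Split

end QWedge

theorem mainTheorem2 {K : Type*} [Field K] (q : K) (hq : q ≠ 0) :
    -- the `q`-antisymmetrizations involved are well-defined formal sums over `S_∞`
    FormalSummable (wedgeTerm q (vacuum 0)) ∧
    (∀ r : ℕ, FormalSummable (wedgeTerm q (omitFactor r (vacuum 0)))) ∧
    -- the two sums over `j = s + 1 ≥ 1` are well-defined formal sums
    FormalSummable (fun s : ℕ => q ^ (3 * s) • termTwo q s) ∧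
    FormalSummable (fun s : ℕ => q ^ (3 * s + 1) • termOne q s) ∧
    -- the image lies in `V(z) ⊗̂ F_(1)`
    PhiTilde q 0 (highestWeight q 0) ∈ completedTensor (Fock q 1) ∧
    -- the formula
    PhiTilde q 0 (highestWeight q 0) =
      formalSum (fun s : ℕ => q ^ (3 * s) • termTwo q s) -
        formalSum (fun s : ℕ => q ^ (3 * s + 1) • termOne q s) := by
  have cases : ∀ b : Label 2, (∃ s : ℕ, b = zv₂ (s + 1)) ∨ (∃ s : ℕ, b = zv₁ (s + 1)) ∨
      ((∀ s : ℕ, zv₂ (s + 1) ≠ b) ∧ ∀ s : ℕ, zv₁ (s + 1) ≠ b) := by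
    intro b
    by_cases h2 : ∃ s : ℕ, b = zv₂ (s + 1)
    · exact Or.inl h2
    · by_cases h1 : ∃ s : ℕ, b = zv₁ (s + 1)
      · exact Or.inr (Or.inl h1)
      · exact Or.inr (Or.inr ⟨fun s h => h2 ⟨s, h.symm⟩, fun s h => h1 ⟨s, h.symm⟩⟩)
  refine ⟨formalSummable_wedgeTerm (N := 0) fun M _ => dominates_vacuum₀ M,
    fun r => formalSummable_wedgeTerm (N := 0) fun M _ => dominates_omitFactor r M,
    formalSummable_smul_tmul _ zv₂_injective _, formalSummable_smul_tmul _ zv₁_injective _,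
    ?_, ?_⟩
  · intro b
    rcases cases b with ⟨s, rfl⟩ | ⟨s, rfl⟩ | ⟨h2, h1⟩
    · simp only [phiTilde_zv₂ hq]
      exact Submodule.smul_mem _ (q ^ (3 * s)) (wedge_omitFactor_mem_Fock q (2 * s))
    · simp only [phiTilde_zv₁ hq]
      exact Submodule.neg_mem _
        (Submodule.smul_mem _ (q ^ (3 * s + 1)) (wedge_omitFactor_mem_Fock q (2 * s + 1)))
    · simp only [phiTilde_eq_zero hq h2 h1]
      exact Submodule.zero_mem _
  · funext ⟨b, w⟩
    rw [Pi.sub_apply]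
    simp only [termTwo, termOne]
    rcases cases b with ⟨s, rfl⟩ | ⟨s, rfl⟩ | ⟨h2, h1⟩
    · rw [phiTilde_zv₂ hq,
        formalSum_smul_tmul_apply (fun s => q ^ (3 * s)) zv₂_injective _ s w,
        formalSum_smul_tmul_apply_eq_zero _ _ (fun s' => zv₁_ne_zv₂ _ _), sub_zero]
    · rw [phiTilde_zv₁ hq,
        formalSum_smul_tmul_apply (fun s => q ^ (3 * s + 1)) zv₁_injective _ s w,
        formalSum_smul_tmul_apply_eq_zero _ _ (fun s' => (zv₁_ne_zv₂ _ _).symm), zero_sub]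
    · rw [phiTilde_eq_zero hq h2 h1, formalSum_smul_tmul_apply_eq_zero _ _ h2,
        formalSum_smul_tmul_apply_eq_zero _ _ h1, sub_zero]
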